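/- **Setting.** Let $G=(V,E)$ be a finite connected loopless 4-regular graph (parallel edges allowed) with $n=|V|$, whose four edges at each vertex are labelled by variables $x_1,x_2,x_3,x_4$. Let $\beta>0$. The four-vertex model $Z_{4V}(G;\beta,1)$ has at each vertex the constraint function $f^*$ with $f^*_{0011}=f^*_{1100}=\beta$, $f^*_{0101}=f^*_{1010}=1$ and $f^*=0$ otherwise; a valid configuration assigns to each half-edge a value in $\{0,1\}$ such that the two halves of every edge differ and, at every vertex, $x_4\ne x_1$ and $x_3\neq x_2$. *Circuits.* Tracing trails that pass through each edge and leave every vertex through the partner of the entering variable ($x_1\leftrightarrow x_4$, $x_2\leftrightarrow x_3$) decomposes the half-edges of $G$ into a set $\mathcal C$ of circuits; $m=|\mathcal C|$. Choose an initial half-edge on each circuit; in a valid configuration its value is the value of the circuit. Let $G_C=(\mathcal C,E_C)$ be the simple graph in which two distinct circuits are adjacent iff they share a vertex of $G$. For $(u,v)\in E_C$, let $A(u,v)$ (resp. $D(u,v)$) be the number of common vertices of $u$ and $v$ at which $f^*$ takes the value $\beta$ (resp. $1$) when $u,v$ have equal values and $1$ (resp. $\beta$) when they have different values. *Hypotheses.*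 Assume that $E_C\ne\varnothing$, that $A(u,v)\neq D(u,v)$ for all $(u,v)\in E_C$, and that $X\in\mathrm{GF}(2)^{\mathcal C}$ satisfies, for all $(u,v)\in E_C$, either $X_u\oplus X_v=\mathbf I(A(u,v)<D(u,v))$ in the case $\beta>1$, or $X_u\oplus X_v=\mathbf I(A(u,v)>D(u,v))$ in the case $0<\beta<1$. Replace the initial half-edge of every circuit $u$ with $X_u=1$ by the other half of the same edge, and let $A,D$ now denote the numbers computed with the new choice. For $e=(u,v)\in E_C$ put $\beta_e=\beta^{A(u,v)-D(u,v)}$, $x_e=\frac{\beta_e-1}{\beta_e+1}$, and $x_{\min}=\min_{e\in E_C}x_e$. *Worm process.* For $S\subseteq E_C$ let $\partial S$ be the set of vertices of odd degree in $(\mathcal C,S)$, let $\Omega_k=\{S\subseteq E_C:|\partial S|=k\}$ and $\Omega=\Omega_0\cup\Omega_2$. Let $\pi(S)\propto\xi(S)\prod_{e\in S}x_e$ on $\Omega$, where $\xi=m$ on $\Omega_0$ and $\xi=2$ on $\Omega_2$. With $d$ the degree in $G_C$, the transition matrix $P$ on $\Omega$ is, for $(u,v)\in E_C$, $$P(S,S\oplus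 uv)=\begin{cases}x_{uv}^{\mathbf I(uv\notin S)}\frac1{2m}\left(\frac1{d(u)}+\frac1{d(v)}\right)&S\in\Omega_0,\\ x_{uv}^{\mathbf I(uv\notin S)}\frac14\left(\frac1{d(u)}+\frac1{d(v)}\right)&S\oplus uv\in\Omega_0,\\ \min\left(1,\frac{d(u)}{d(v)}x_{uv}^{\mathbf I(uv\notin S)-\mathbf I(uv\in S)}\right)\frac1{4d(u)}&S,\,S\oplus uv\in\Omega_2,\ u\in\partial S,\end{cases}$$ all other off-diagonal entries are $0$, and the rows sum to $1$. **Theorem.** $P$ is a stochastic matrix with stationary distribution $\pi$, and for every $0<\varepsilon\le1$ its mixing time $\tau_\varepsilon(P)=\min\{t\in\mathbb N:\max_{S\in\Omega}\|P^t(S,\cdot)-\pi\|_{\mathrm{TV}}\le\varepsilon\}$ exists and satisfies $$\tau_\varepsilon(P)\le 4n^5|E_C|^2\left(\frac{\ln(2\varepsilon^{-1})}{|E_C|}+\ln\frac{2}{x_{\min}}\right).$$ -/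

import Mathlib

open Finset
open scoped Graph symmDiff

noncomputable section

namespace FourVertex

/-! ### The four-vertex model on a labelled 4-regular graph -/

variable {V E : Type*}

/-- A labelling of the four edges incident to each vertex `v` of `G` by the variables
`x₁, x₂, x₃, x₄` (numbered `0, 1, 2, 3`) of the constraint function at `v`. A loopless graph
that has one is 4-regular. -/
abbrev Labelling (G : Graph V E) : Type _ :=
  ∀ v : V(G), Fin 4 ≃ G.incidenceSet (v : V)

/-- The half-edges of `G`: the edges `(u_e, u_v)` of the edge-vertex incidence graph of `G`. -/
abbrev HalfEdge (G : Graph V E) : Type _ :=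
  Σ v : V(G), G.incidenceSet (v : V)

variable {G : Graph V E}

/-- The other half of the same edge. -/
def opp (h : HalfEdge G) : HalfEdge G :=
  have hi : G.Inc (h.2 : E) (h.1 : V) := h.2.2
  ⟨⟨hi.other, hi.inc_other.vertex_mem⟩, ⟨(h.2 : E), hi.inc_other⟩⟩

/-- The half-edge that carries the variable `x_{k+1}` of the constraint function at `v`. -/
def slot (lab : Labelling G) (v : V(G)) (k : Fin 4) : HalfEdge G :=
  ⟨v, lab v k⟩

/-- The half-edge at the same vertex in the same pair of variables,
`x₁ ↔ x₄` and `x₂ ↔ x₃`. -/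
def across (lab : Labelling G) (h : HalfEdge G) : HalfEdge G :=
  slot lab h.1 (Fin.rev ((lab h.1).symm h.2))

/-- Two half-edges lie on the same circuit when the trail that passes straight through edges and
leaves each vertex through the other variable of the entering pair leads from one to the other. -/
def circuitSetoid (lab : Labelling G) : Setoid (HalfEdge G) :=
  Relation.EqvGen.setoid fun h h' => h' = opp h ∨ h' = across lab h

/-- The set `𝒞` of circuits of the circuit decomposition. -/
def Circuit (lab : Labelling G) : Type _ := Quotient (circuitSetoid lab)

/-- The circuit of a half-edge. -/
def circuitOf (lab : Labelling G) (h : HalfEdge G) : Circuit lab :=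
  Quotient.mk (circuitSetoid lab) h

instance (lab : Labelling G) : DecidableEq (Circuit lab) := Classical.decEq _

instance [Finite V(G)] (lab : Labelling G) : Finite (Circuit lab) := by
  have : ∀ v : V(G), Finite (G.incidenceSet (v : V)) := fun v => Finite.of_equiv _ (lab v)
  exact Quotient.finite _

instance [Finite V(G)] (lab : Labelling G) : Fintype (Circuit lab) := Fintype.ofFinite _

/-- The normalized constraint function of the four-vertex model: `f_{0011} = f_{1100} = β`,
`f_{0101} = f_{1010} = 1`, and `0` at every other input. -/
def fStar (β : ℝ) (x : Fin 4 → Bool) : ℝ :=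
  if x 3 = !x 0 ∧ x 2 = !x 1 then (if x 0 = x 1 then β else 1) else 0

/-- Valid configurations: the two halves of an edge take different values, and the constraint
function at each vertex is on its support, that is, `x₄ ≠ x₁` and `x₃ ≠ x₂`. -/
def IsValid (lab : Labelling G) (σ : HalfEdge G → Bool) : Prop :=
  (∀ h, σ (opp h) = !σ h) ∧
    ∀ v, σ (slot lab v 3) = !σ (slot lab v 0) ∧ σ (slot lab v 2) = !σ (slot lab v 1)

/-- The circuit `c` passes through the vertex `v`. -/
def Passes (lab : Labelling G) (c : Circuit lab) (v : V(G)) : Prop :=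
  ∃ k, circuitOf lab (slot lab v k) = c

/-- The graph of circuits `G_C`: two circuits are adjacent when they share a vertex. -/
def circuitGraph (lab : Labelling G) : SimpleGraph (Circuit lab) where
  Adj c d := c ≠ d ∧ ∃ v, Passes lab c v ∧ Passes lab d v
  symm := ⟨fun _ _ h => ⟨h.1.symm, h.2.imp fun _ hv => hv.symm⟩⟩
  loopless := ⟨fun _ h => h.1 rfl⟩

instance (lab : Labelling G) : DecidableRel (circuitGraph lab).Adj := Classical.decRel _

/-- A choice of an initial half-edge on each circuit. In a valid configuration the value of a
circuit is the value of its initial half-edge. -/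
structure Initial (lab : Labelling G) where
  edge : Circuit lab → HalfEdge G
  mem : ∀ c, circuitOf lab (edge c) = c

/-- A common vertex `v` of `c` and `d` is an agree-vertex if the constraint function at `v` takes
the value `β` when `c` and `d` are assigned the same value, and `1` when they are not. -/
def IsAgree (β : ℝ) (lab : Labelling G) (I : Initial lab) (c d : Circuit lab) (v : V(G)) : Prop :=
  (Passes lab c v ∧ Passes lab d v) ∧ ∀ σ, IsValid lab σ →
    fStar β (fun k => σ (slot lab v k)) = if σ (I.edge c) = σ (I.edge d) then β else 1

/-- A common vertex `v` of `c` and `d` is a disagree-vertex if the constraint function at `v` takes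
the value `1` when `c` and `d` are assigned the same value, and `β` when they are not. -/
def IsDisagree (β : ℝ) (lab : Labelling G) (I : Initial lab) (c d : Circuit lab) (v : V(G)) :
    Prop :=
  (Passes lab c v ∧ Passes lab d v) ∧ ∀ σ, IsValid lab σ →
    fStar β (fun k => σ (slot lab v k)) = if σ (I.edge c) = σ (I.edge d) then 1 else β

/-- `A(c, d)`, the number of agree-vertices. -/
def numAgree (β : ℝ) (lab : Labelling G) (I : Initial lab) (c d : Circuit lab) : ℕ :=
  {v | IsAgree β lab I c d v}.ncard

/-- `D(c, d)`, the number of disagree-vertices. -/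
def numDisagree (β : ℝ) (lab : Labelling G) (I : Initial lab) (c d : Circuit lab) : ℕ :=
  {v | IsDisagree β lab I c d v}.ncard

theorem numAgree_comm (β : ℝ) (lab : Labelling G) (I : Initial lab) (c d : Circuit lab) :
    numAgree β lab I c d = numAgree β lab I d c := by
  have h (σ : HalfEdge G → Bool) : (σ (I.edge c) = σ (I.edge d)) = (σ (I.edge d) = σ (I.edge c)) :=
    propext eq_comm
  simp only [numAgree, IsAgree, and_comm (a := Passes lab c _), h]

theorem numDisagree_comm (β : ℝ) (lab : Labelling G) (I : Initial lab) (c d : Circuit lab) :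
    numDisagree β lab I c d = numDisagree β lab I d c := by
  have h (σ : HalfEdge G → Bool) : (σ (I.edge c) = σ (I.edge d)) = (σ (I.edge d) = σ (I.edge c)) :=
    propext eq_comm
  simp only [numDisagree, IsDisagree, and_comm (a := Passes lab c _), h]

/-- The linear system over GF(2) for `β > 1`. -/
def SolvesFerro (β : ℝ) (lab : Labelling G) (I : Initial lab) (X : Circuit lab → ZMod 2) : Prop :=
  ∀ c d, (circuitGraph lab).Adj c d →
    X c + X d = if numAgree β lab I c d < numDisagree β lab I c d then 1 else 0

/-- The linear system over GF(2) for `β < 1`. -/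
def SolvesAntiferro (β : ℝ) (lab : Labelling G) (I : Initial lab) (X : Circuit lab → ZMod 2) :
    Prop :=
  ∀ c d, (circuitGraph lab).Adj c d →
    X c + X d = if numAgree β lab I c d > numDisagree β lab I c d then 1 else 0

theorem circuitOf_opp (lab : Labelling G) (h : HalfEdge G) :
    circuitOf lab (opp h) = circuitOf lab h :=
  Quotient.sound (Relation.EqvGen.symm _ _ (Relation.EqvGen.rel _ _ (Or.inl rfl)))

/-- Move the initial half-edge of each circuit `c` with `X c = 1` to an adjacent half-edge of the
same circuit. -/
def Initial.change {lab : Labelling G} (I : Initial lab) (X : Circuit lab → ZMod 2) :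
    Initial lab where
  edge c := if X c = 1 then opp (I.edge c) else I.edge c
  mem c := by
    split_ifs
    · rw [circuitOf_opp, I.mem]
    · exact I.mem c

/-- `β_e = β ^ (A(c, d) - D(c, d))` for `e = (c, d)`. -/
def edgeBeta (β : ℝ) (lab : Labelling G) (I : Initial lab) : Sym2 (Circuit lab) → ℝ :=
  Sym2.lift ⟨fun c d => β ^ ((numAgree β lab I c d : ℤ) - (numDisagree β lab I c d : ℤ)),
    fun c d => by simp only [numAgree_comm β lab I c d, numDisagree_comm β lab I c d]⟩

/-- `x_e = (β_e - 1) / (β_e + 1)`. -/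
def edgeX (β : ℝ) (lab : Labelling G) (I : Initial lab) (e : Sym2 (Circuit lab)) : ℝ :=
  (edgeBeta β lab I e - 1) / (edgeBeta β lab I e + 1)

/-- `x_min`, the minimum of `x_e` over the edges of `G_C` (used when there is an edge). -/
def xMin (β : ℝ) (lab : Labelling G) (I : Initial lab) : ℝ :=
  ⨅ e : (circuitGraph lab).edgeSet, edgeX β lab I e

end FourVertex

/-! ### The worm process on a finite graph with edge weights -/

namespace Worm

variable {C : Type*} [Fintype C] [DecidableEq C]

/-- `∂A`, the set of vertices of odd degree in the subgraph with edge set `A`. -/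
def odd (A : Finset (Sym2 C)) : Finset C :=
  {v | Odd #{e ∈ A | v ∈ e}}

variable (H : SimpleGraph C) [DecidableRel H.Adj]

/-- `Ω_worm`: subgraphs (given by their edge sets) with exactly `0` or `2` odd vertices. -/
abbrev State : Type _ :=
  {A : Finset (Sym2 C) // A ⊆ H.edgeFinset ∧ (#(odd A) = 0 ∨ #(odd A) = 2)}

/-- `w(A)`, the product of the edge weights. -/
def weight (x : Sym2 C → ℝ) (A : Finset (Sym2 C)) : ℝ := ∏ e ∈ A, x e

/-- `w_worm(A) = ξ(A) w(A)` with `ξ = m` on `Ω₀` and `ξ = 2` on `Ω₂`. -/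
def wormWeight (x : Sym2 C → ℝ) (A : State H) : ℝ :=
  (if #(odd A.1) = 0 then (Fintype.card C : ℝ) else 2) * weight x A.1

/-- The worm measure `π_worm`. -/
def wormMeasure (x : Sym2 C → ℝ) (A : State H) : ℝ :=
  wormWeight H x A / ∑ B, wormWeight H x B

/-- The probability that the lazy Metropolis chain at `A` moves, selects the vertex `u` and then
its neighbour `v`, and accepts `A ⊕ uv`. -/
def moveProb (x : Sym2 C → ℝ) (A : Finset (Sym2 C)) (u v : C) : ℝ :=
  if #(odd A) = 0 then
    (if s(u, v) ∉ A then x s(u, v) else 1) * (1 / (2 * (Fintype.card C : ℝ))) * (1 / H.degree u)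
  else if u ∈ odd A then
    if #(odd (A ∆ {s(u, v)})) = 0 then
      (if s(u, v) ∉ A then x s(u, v) else 1) * (1 / 4) * (1 / H.degree u)
    else
      min 1 ((H.degree u : ℝ) / H.degree v * if s(u, v) ∉ A then x s(u, v) else (x s(u, v))⁻¹)
        * (1 / (4 * (H.degree u : ℝ)))
  else 0

/-- The off-diagonal transition probabilities. An edge `uv` with `B = A ⊕ uv` occurs in the sum in
both orientations: this gives the factor `1/d(u) + 1/d(v)` when `A` or `B` has no odd vertex, and
the single term of the end that is odd in `A` otherwise. -/
def offDiagProb (x : Sym2 C → ℝ) (A B : State H) : ℝ :=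
  ∑ p : C × C with H.Adj p.1 p.2 ∧ B.1 = A.1 ∆ {s(p.1, p.2)}, moveProb H x A.1 p.1 p.2

/-- The transition matrix of the lazy Metropolis worm process. -/
def transition (x : Sym2 C → ℝ) : Matrix (State H) (State H) ℝ :=
  Matrix.of fun A B =>
    if A = B then 1 - ∑ B' ∈ univ.erase A, offDiagProb H x A B' else offDiagProb H x A B

end Worm

/-! ### Mixing time -/

namespace MarkovChain

variable {S : Type*} [Fintype S] [DecidableEq S]

/-- Total variation distance. -/
def tvDist (p q : S → ℝ) : ℝ := (1 / 2) * ∑ x, |p x - q x|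

/-- `τ_ε(P) = min {t : max_x ‖P^t(x, ·) - π‖_TV ≤ ε}`, which is `⊤` if there is no such `t`. -/
def mixingTime (P : Matrix S S ℝ) (π : S → ℝ) (ε : ℝ) : ℕ∞ :=
  ⨅ (t : ℕ) (_ : ∀ x, tvDist ((P ^ t) x) π ≤ ε), (t : ℕ∞)

/-- `P` is a stochastic matrix and `π` is a stationary probability distribution of it. -/
def IsStationary (P : Matrix S S ℝ) (π : S → ℝ) : Prop :=
  P ∈ Matrix.rowStochastic ℝ S ∧ π ∈ stdSimplex ℝ S ∧ Matrix.vecMul π P = π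

end MarkovChain

end

/-! Moving the initial half-edges along the solution `X` makes every `β_e > 1`
(`one_lt_edgeBeta_change`), so every `x_e` lies in (0, 1). What remains concerns the worm chain on
any finite graph with such weights. Detailed balance gives stationarity, and proposals have total
mass at most 1/2, so the chain is lazy and a Poincaré inequality controls its mixing
(`tvDist_le_of_poincare`).

That inequality (`wormWeight_poincare`) comes from canonical paths. For f of mean zero it suffices
to compare f on all states A with f on even subgraphs F. Then D = A ∆ F is again a worm state, its
edges can be deleted one by one inside Ω (`exists_unwinding`), and translating by F gives a path
from A to F. For fixed D a transition determines F. If T is the larger of the two sets of the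
transition, w(A) w(F) = w(T) w(T ∆ D). So congestion reduces to ∑_D ξ(D) w(T ∆ D), which is at most
m² times the weight of the even subgraphs, because Ising correlations are at most 1 (`oddSum_le`).
With path length at most |E_C| and stationary flow at least w(T)/(2m) (unnormalized), the Poincaré
constant is 4m³|E_C|.

Finally m ≤ n, as a circuit has at least four half-edges (`card_circuit_le`), and 1/π ≤ m
(2/x_min)^|E_C|. A spare factor m² absorbs the lower-order terms and yields n⁵. -/

namespace MarkovChain

/-! ### L²(π) contraction of lazy reversible chains -/

section Contraction

variable {S : Type*} [Fintype S]

/-- Jensen in each row, then reversibility turns the weighted column sums into π. -/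
theorem sum_sq_mulVec_le {Q : Matrix S S ℝ} {π : S → ℝ} (hπ : ∀ x, 0 ≤ π x)
    (hQ : ∀ x y, 0 ≤ Q x y) (hrow : ∀ x, ∑ y, Q x y = 1)
    (hrev : ∀ x y, π x * Q x y = π y * Q y x) (f : S → ℝ) :
    ∑ x, π x * (∑ y, Q x y * f y) ^ 2 ≤ ∑ x, π x * f x ^ 2 := by
  have jensen (x : S) : (∑ y, Q x y * f y) ^ 2 ≤ ∑ y, Q x y * f y ^ 2 := by
    have := sum_sq_le_sum_mul_sum_of_sq_le_mul (R := ℝ) univ (r := fun y => Q x y * f y)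
      (f := fun y => Q x y) (g := fun y => Q x y * f y ^ 2) (fun y _ => hQ x y)
      (fun y _ => mul_nonneg (hQ x y) (sq_nonneg _)) (fun y _ => le_of_eq (by ring))
    rwa [hrow, one_mul] at this
  calc ∑ x, π x * (∑ y, Q x y * f y) ^ 2
      ≤ ∑ x, π x * ∑ y, Q x y * f y ^ 2 :=
        sum_le_sum fun x _ => mul_le_mul_of_nonneg_left (jensen x) (hπ x)
    _ = ∑ y, ∑ x, π x * Q x y * f y ^ 2 := by
        rw [sum_comm]
        simp only [mul_sum, mul_assoc]
    _ = ∑ y, π y * f y ^ 2 := by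
        refine sum_congr rfl fun y _ => ?_
        rw [← sum_mul]
        simp only [hrev _ y]
        rw [← mul_sum, hrow, mul_one]

variable {P : Matrix S S ℝ} {π : S → ℝ}

/-- A lazy reversible transition operator dominates its square. -/
theorem sum_sq_mulVec_le_of_lazy (hπ : ∀ x, 0 ≤ π x)
    (hP : ∀ x y, 0 ≤ P x y) (hrow : ∀ x, ∑ y, P x y = 1)
    (hrev : ∀ x y, π x * P x y = π y * P y x) (hlazy : ∀ x, 1 / 2 ≤ P x x) (f : S → ℝ) :
    ∑ x, π x * (∑ y, P x y * f y) ^ 2 ≤ ∑ x, π x * (f x * ∑ y, P x y * f y) := by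
  classical
  have hQf (x : S) : ∑ y, (2 * P x y - if x = y then 1 else 0) * f y
      = 2 * (∑ y, P x y * f y) - f x := by
    simp [sub_mul, sum_sub_distrib, mul_sum, mul_assoc]
  -- Laziness makes 2P − I stochastic. Expanding ‖(2P − I)f‖² ≤ ‖f‖² gives the claim.
  have key := sum_sq_mulVec_le (Q := Matrix.of fun x y => 2 * P x y - if x = y then 1 else 0) hπ
    (fun x y => by
      by_cases h : x = y
      · subst h
        simp only [Matrix.of_apply, if_true]
        linarith [hlazy x]
      · simp [h, hP x y])
    (fun x => by simp [sum_sub_distrib, ← mul_sum, hrow]; norm_num)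
    (fun x y => by
      by_cases h : x = y
      · subst h; rfl
      · simp only [Matrix.of_apply, h, Ne.symm h, if_false, sub_zero]
        linarith [hrev x y])
    f
  simp only [Matrix.of_apply, hQf] at key
  have expand : ∑ x, π x * (2 * (∑ y, P x y * f y) - f x) ^ 2
      = 4 * ∑ x, π x * (∑ y, P x y * f y) ^ 2
        - 4 * ∑ x, π x * (f x * ∑ y, P x y * f y) + ∑ x, π x * f x ^ 2 := by
    rw [mul_sum, mul_sum, ← sum_sub_distrib, ← sum_add_distrib]
    exact sum_congr rfl fun x _ => by ring
  linarith

theorem sum_sub_sum_mulVec_eq_dirichlet (hrow : ∀ x, ∑ y, P x y = 1)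
    (hrev : ∀ x y, π x * P x y = π y * P y x) (f : S → ℝ) :
    ∑ x, π x * f x ^ 2 - ∑ x, π x * (f x * ∑ y, P x y * f y)
      = 1 / 2 * ∑ x, ∑ y, π x * P x y * (f x - f y) ^ 2 := by
  have h1 : ∑ x, ∑ y, π x * P x y * f x ^ 2 = ∑ x, π x * f x ^ 2 :=
    sum_congr rfl fun x _ => by rw [← sum_mul, ← mul_sum, hrow, mul_one]
  have h2 : ∑ x, ∑ y, π x * P x y * f y ^ 2 = ∑ x, π x * f x ^ 2 := by
    rw [sum_comm, ← h1]
    exact sum_congr rfl fun x _ => sum_congr rfl fun y _ => by rw [hrev]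
  have h3 : ∑ x, ∑ y, π x * P x y * (f x * f y) = ∑ x, π x * (f x * ∑ y, P x y * f y) := by
    refine sum_congr rfl fun x _ => ?_
    rw [mul_sum, mul_sum]
    exact sum_congr rfl fun y _ => by ring
  have h4 : ∑ x, ∑ y, π x * P x y * (f x - f y) ^ 2
      = ∑ x, ∑ y, π x * P x y * f x ^ 2 + ∑ x, ∑ y, π x * P x y * f y ^ 2
        - 2 * ∑ x, ∑ y, π x * P x y * (f x * f y) := by
    simp only [mul_sum, ← sum_add_distrib, ← sum_sub_distrib]
    exact sum_congr rfl fun x _ => sum_congr rfl fun y _ => by ring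
  rw [h4, h1, h2, h3]
  ring

/-- Laziness gives ‖Pf‖² ≤ ⟨f, Pf⟩, and this is ‖f‖² minus the Dirichlet form, so no bound on
negative eigenvalues is needed. -/
theorem sum_sq_mulVec_le_of_poincare (hπ : ∀ x, 0 ≤ π x)
    (hP : ∀ x y, 0 ≤ P x y) (hrow : ∀ x, ∑ y, P x y = 1)
    (hrev : ∀ x y, π x * P x y = π y * P y x) (hlazy : ∀ x, 1 / 2 ≤ P x x)
    {K : ℝ} (hK : 0 < K)
    (hpoin : ∀ f : S → ℝ, ∑ x, π x * f x = 0 →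
      ∑ x, π x * f x ^ 2 ≤ K * (1 / 2 * ∑ x, ∑ y, π x * P x y * (f x - f y) ^ 2))
    (f : S → ℝ) (hf : ∑ x, π x * f x = 0) :
    ∑ x, π x * (∑ y, P x y * f y) ^ 2 ≤ (1 - 1 / K) * ∑ x, π x * f x ^ 2 := by
  have h1 := sum_sq_mulVec_le_of_lazy hπ hP hrow hrev hlazy f
  have h2 := sum_sub_sum_mulVec_eq_dirichlet hrow hrev f
  have h3 : 1 / K * ∑ x, π x * f x ^ 2
      ≤ 1 / 2 * ∑ x, ∑ y, π x * P x y * (f x - f y) ^ 2 := by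
    rw [one_div, inv_mul_le_iff₀ hK]
    exact hpoin f hf
  linarith

end Contraction

/-! ### From a Poincaré inequality to total variation -/

variable {S : Type*} [Fintype S] [DecidableEq S] {P : Matrix S S ℝ} {π : S → ℝ}

theorem sum_pow_row (hrow : ∀ x, ∑ y, P x y = 1) (t : ℕ) (x : S) : ∑ y, (P ^ t) x y = 1 := by
  induction t with
  | zero => simp [Matrix.one_apply]
  | succ t ih =>
    simp only [pow_succ, Matrix.mul_apply]
    rw [sum_comm]
    simp only [← mul_sum, hrow, mul_one, ih]

/-- Decay of the `χ²`-distance to stationarity. -/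
theorem sum_sq_density_sub_one_le (hπ : ∀ x, 0 < π x) (hπ1 : ∑ x, π x = 1)
    (hP : ∀ x y, 0 ≤ P x y) (hrow : ∀ x, ∑ y, P x y = 1)
    (hrev : ∀ x y, π x * P x y = π y * P y x) (hlazy : ∀ x, 1 / 2 ≤ P x x)
    {K : ℝ} (hK : 1 ≤ K)
    (hpoin : ∀ f : S → ℝ, ∑ x, π x * f x = 0 →
      ∑ x, π x * f x ^ 2 ≤ K * (1 / 2 * ∑ x, ∑ y, π x * P x y * (f x - f y) ^ 2))
    (t : ℕ) (x : S) :
    ∑ y, π y * ((P ^ t) x y / π y - 1) ^ 2 ≤ (1 - 1 / K) ^ t * (1 / π x) := by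
  have hK0 : 0 < K := by linarith
  induction t with
  | zero =>
    -- The sum over y is 1/π(x) − 2 + 1, the χ²-distance of the point mass at x.
    have h1 (y : S) : π y * ((P ^ 0) x y / π y - 1) ^ 2
        = (if x = y then 1 / π x - 2 else 0) + π y := by
      have := (hπ y).ne'
      by_cases h : x = y
      · subst h
        simp only [pow_zero, Matrix.one_apply_eq, if_true]
        field_simp
        ring
      · simp [h]
    simp only [h1, sum_add_distrib, hπ1, sum_ite_eq, mem_univ, if_true]
    simp
    linarith
  | succ t ih =>
    -- By reversibility the density of P^t(x, ·) with respect to π evolves by applying P itself, so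
    -- the contraction iterates.
    have hstep (y : S) : (P ^ (t + 1)) x y / π y - 1
        = ∑ z, P y z * ((P ^ t) x z / π z - 1) := by
      simp only [mul_sub, mul_one, sum_sub_distrib, hrow, pow_succ, Matrix.mul_apply, sum_div]
      congr 1
      refine sum_congr rfl fun z _ => ?_
      have h1 := (hπ y).ne'
      have h2 := (hπ z).ne'
      field_simp
      linear_combination (P ^ t) x z * hrev z y
    have hmean : ∑ y, π y * ((P ^ t) x y / π y - 1) = 0 := by
      have (y : S) : π y * ((P ^ t) x y / π y - 1) = (P ^ t) x y - π y := by
        have := (hπ y).ne'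
        field_simp
      simp only [this, sum_sub_distrib, hπ1, sum_pow_row hrow, sub_self]
    simp only [hstep]
    calc _ ≤ (1 - 1 / K) * ∑ y, π y * ((P ^ t) x y / π y - 1) ^ 2 :=
          sum_sq_mulVec_le_of_poincare (fun x => (hπ x).le) hP hrow hrev hlazy hK0 hpoin _ hmean
      _ ≤ (1 - 1 / K) * ((1 - 1 / K) ^ t * (1 / π x)) := by
          refine mul_le_mul_of_nonneg_left ih ?_
          rw [sub_nonneg, div_le_one hK0]
          exact hK
      _ = _ := by ring

/-- Cauchy–Schwarz with respect to π: the L¹ norm of the centred density is at most its L² norm. -/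
theorem sq_tvDist_le (hπ : ∀ x, 0 < π x) (hπ1 : ∑ x, π x = 1) (p : S → ℝ) :
    tvDist p π ^ 2 ≤ 1 / 4 * ∑ y, π y * (p y / π y - 1) ^ 2 := by
  have h1 : ∑ y, |p y - π y| = ∑ y, π y * |p y / π y - 1| := by
    refine sum_congr rfl fun y _ => ?_
    have h := hπ y
    rw [← abs_of_pos h, ← abs_mul, abs_of_pos h]
    congr 1
    field_simp
  have h2 := sum_sq_le_sum_mul_sum_of_sq_le_mul (R := ℝ) univ
    (r := fun y => π y * |p y / π y - 1|)
    (f := π) (g := fun y => π y * (p y / π y - 1) ^ 2) (fun y _ => (hπ y).le)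
    (fun y _ => mul_nonneg (hπ y).le (sq_nonneg _)) (fun y _ => le_of_eq (by rw [mul_pow, sq_abs]; ring))
  rw [hπ1, one_mul, ← h1] at h2
  rw [tvDist, mul_pow]
  linarith

theorem tvDist_le_of_poincare (hπ : ∀ x, 0 < π x) (hπ1 : ∑ x, π x = 1)
    (hP : ∀ x y, 0 ≤ P x y) (hrow : ∀ x, ∑ y, P x y = 1)
    (hrev : ∀ x y, π x * P x y = π y * P y x) (hlazy : ∀ x, 1 / 2 ≤ P x x)
    {K : ℝ} (hK : 1 ≤ K)
    (hpoin : ∀ f : S → ℝ, ∑ x, π x * f x = 0 →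
      ∑ x, π x * f x ^ 2 ≤ K * (1 / 2 * ∑ x, ∑ y, π x * P x y * (f x - f y) ^ 2))
    {ε : ℝ} (hε : 0 < ε) (t : ℕ) (x : S)
    (ht : K * (Real.log (1 / π x) + 2 * Real.log (1 / ε)) ≤ t) :
    tvDist ((P ^ t) x) π ≤ ε := by
  have hK0 : 0 < K := by linarith
  have h1 := sq_tvDist_le hπ hπ1 ((P ^ t) x)
  have h2 := sum_sq_density_sub_one_le hπ hπ1 hP hrow hrev hlazy hK hpoin t x
  have h3 : (1 - 1 / K) ^ t ≤ Real.exp (-(t / K)) := by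
    have : 1 - 1 / K ≤ Real.exp (-(1 / K)) := Real.one_sub_le_exp_neg _
    calc (1 - 1 / K) ^ t ≤ Real.exp (-(1 / K)) ^ t := by
          refine pow_le_pow_left₀ ?_ this t
          rw [sub_nonneg, div_le_one hK0]
          exact hK
      _ = _ := by rw [← Real.exp_nat_mul]; congr 1; ring
  -- The target is ε² because χ² controls the square of the distance; this is the origin of 2
  -- log(1/ε).
  have h4 : Real.exp (-(t / K)) ≤ π x * ε ^ 2 := by
    rw [← Real.le_log_iff_exp_le (by have := hπ x; positivity),
      Real.log_mul (hπ x).ne' (by positivity), Real.log_pow]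
    rw [one_div, one_div, Real.log_inv, Real.log_inv] at ht
    rw [neg_le, le_div_iff₀ hK0]
    push_cast
    linarith
  have h5 : (1 - 1 / K) ^ t * (1 / π x) ≤ ε ^ 2 := by
    rw [mul_one_div, div_le_iff₀ (hπ x)]
    linarith
  refine abs_le_of_sq_le_sq' ?_ hε.le |>.2
  linarith [sq_nonneg ε]

theorem exists_mixingTime_eq {P : Matrix S S ℝ} {π : S → ℝ} {ε B : ℝ} {t : ℕ}
    (ht : ∀ x, tvDist ((P ^ t) x) π ≤ ε) (hB : (t : ℝ) ≤ B) :
    ∃ s : ℕ, mixingTime P π ε = s ∧ (s : ℝ) ≤ B := by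
  have h : mixingTime P π ε ≤ t := iInf₂_le t ht
  obtain ⟨s, hs⟩ := ENat.ne_top_iff_exists.1 (ne_top_of_le_ne_top (ENat.natCast_ne_top t) h)
  refine ⟨s, hs.symm, le_trans ?_ hB⟩
  rw [← hs] at h
  exact_mod_cast h

end MarkovChain

/-! ### Odd-degree sets under symmetric difference -/

namespace Worm

variable {C : Type*} [Fintype C] [DecidableEq C]

theorem mem_odd {A : Finset (Sym2 C)} {v : C} : v ∈ odd A ↔ Odd #{e ∈ A | v ∈ e} := by
  simp [odd]

@[simp] theorem odd_empty : odd (∅ : Finset (Sym2 C)) = ∅ := by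
  ext v; simp [mem_odd]

theorem odd_card_symmDiff {α : Type*} [DecidableEq α] (s t : Finset α) :
    Odd #(s ∆ t) ↔ ¬(Odd #s ↔ Odd #t) := by
  have h1 : #(s ∆ t) = #(s \ t) + #(t \ s) := card_union_of_disjoint disjoint_sdiff_sdiff
  have h2 := card_sdiff_add_card_inter s t
  have h3 := card_sdiff_add_card_inter t s
  rw [inter_comm] at h3
  grind

theorem filter_symmDiff' {α : Type*} [DecidableEq α] (p : α → Prop) [DecidablePred p]
    (s t : Finset α) : {e ∈ s ∆ t | p e} = {e ∈ s | p e} ∆ {e ∈ t | p e} := by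
  ext e; simp only [mem_filter, mem_symmDiff]; tauto

/-- Degrees modulo 2 are additive: `odd` is the boundary map over GF(2). -/
theorem odd_symmDiff (A B : Finset (Sym2 C)) : odd (A ∆ B) = odd A ∆ odd B := by
  ext v
  rw [mem_symmDiff, mem_odd, mem_odd, mem_odd, filter_symmDiff', odd_card_symmDiff]
  tauto

theorem odd_singleton (u v : C) : odd {s(u, v)} = {u, v} := by
  ext w
  rw [mem_odd, filter_singleton]
  by_cases hw : w ∈ s(u, v)
  · rw [if_pos hw]
    simpa using hw
  · rw [if_neg hw]
    simpa using hw

/-! ### High-temperature expansion -/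

/-- The product over `U` of the spins that are `-1` exactly on `T`. -/
def spinChar (T U : Finset C) : ℝ := ∏ v ∈ T, if v ∈ U then -1 else 1

theorem spinChar_symmDiff (T U W : Finset C) :
    spinChar T (U ∆ W) = spinChar T U * spinChar T W := by
  rw [spinChar, spinChar, spinChar, ← prod_mul_distrib]
  refine prod_congr rfl fun v _ => ?_
  by_cases h1 : v ∈ U <;> by_cases h2 : v ∈ W <;> simp [mem_symmDiff, h1, h2]

theorem abs_spinChar (T U : Finset C) : |spinChar T U| = 1 := by
  rw [spinChar, abs_prod]
  refine prod_eq_one fun v _ => ?_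
  split_ifs <;> simp

theorem spinChar_empty (T : Finset C) : spinChar T ∅ = 1 := by simp [spinChar]

/-- Orthogonality of characters: the sum factors over vertices, and any vertex of U contributes 1 +
(−1). -/
theorem sum_spinChar (U : Finset C) :
    ∑ T : Finset C, spinChar T U = if U = ∅ then 2 ^ Fintype.card C else 0 := by
  have h := prod_one_add (univ : Finset C) (f := fun v => if v ∈ U then (-1 : ℝ) else 1)
  rw [powerset_univ] at h
  simp only [spinChar]
  rw [← h]
  split_ifs with hU
  · subst hU
    norm_num
  · obtain ⟨v, hv⟩ := nonempty_iff_ne_empty.2 hU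
    exact prod_eq_zero (mem_univ v) (by simp [hv])

theorem prod_spinChar (T : Finset C) (S : Finset (Sym2 C)) :
    ∏ e ∈ S, spinChar T (odd {e}) = spinChar T (odd S) := by
  induction S using Finset.induction_on with
  | empty => simp [spinChar_empty]
  | insert e S he ih =>
    have : insert e S = {e} ∆ S := by
      ext a; simp only [mem_insert, mem_symmDiff, mem_singleton]; grind
    rw [prod_insert he, ih, this, odd_symmDiff, spinChar_symmDiff]

variable (H : SimpleGraph C) [DecidableRel H.Adj]

/-- The total weight of the subgraphs whose set of odd vertices is `W`. -/
def oddSum (x : Sym2 C → ℝ) (W : Finset C) : ℝ :=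
  ∑ A ∈ H.edgeFinset.powerset with odd A = W, weight x A

variable {H} {x : Sym2 C → ℝ}

/-- Expand the product over edges into subgraphs A. Each carries the spin product over `odd A`, and
averaging over spins against the character of W keeps only `odd A = W`. The result is an
unnormalized Ising correlation. -/
theorem two_pow_mul_oddSum (W : Finset C) :
    2 ^ Fintype.card C * oddSum H x W
      = ∑ T : Finset C, spinChar T W * ∏ e ∈ H.edgeFinset, (1 + x e * spinChar T (odd {e})) := by
  have h1 (T : Finset C) : ∏ e ∈ H.edgeFinset, (1 + x e * spinChar T (odd {e}))
      = ∑ A ∈ H.edgeFinset.powerset, weight x A * spinChar T (odd A) := by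
    rw [prod_one_add]
    refine sum_congr rfl fun A _ => ?_
    rw [prod_mul_distrib, prod_spinChar, weight]
  simp only [h1, mul_sum]
  rw [sum_comm, oddSum, sum_filter, mul_sum]
  refine sum_congr rfl fun A _ => ?_
  have h2 : ∑ T : Finset C, spinChar T W * (weight x A * spinChar T (odd A))
      = weight x A * ∑ T : Finset C, spinChar T (odd A ∆ W) := by
    rw [mul_sum]
    refine sum_congr rfl fun T _ => ?_
    rw [spinChar_symmDiff]
    ring
  rw [h2, sum_spinChar, ← bot_eq_empty]
  simp only [symmDiff_eq_bot]
  split_ifs <;> ring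

/-- Correlations are at most 1: in the spin expansion all Boltzmann factors 1 ± x_e are nonnegative,
and dropping the character ±1 can only increase the sum. -/
theorem oddSum_le (hx0 : ∀ e ∈ H.edgeFinset, 0 < x e) (hx1 : ∀ e ∈ H.edgeFinset, x e ≤ 1)
    (W : Finset C) : oddSum H x W ≤ oddSum H x ∅ := by
  have h2 : (0 : ℝ) < 2 ^ Fintype.card C := by positivity
  rw [← mul_le_mul_iff_right₀ h2, two_pow_mul_oddSum, two_pow_mul_oddSum]
  refine sum_le_sum fun T _ => mul_le_mul_of_nonneg_right ?_ (prod_nonneg fun e he => ?_)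
  · rw [spinChar_empty, ← abs_spinChar T W]
    exact le_abs_self _
  · have h := (abs_le.1 (abs_spinChar T (odd {e})).le).1
    nlinarith [hx0 e he, hx1 e he]

theorem weight_pos (hx0 : ∀ e ∈ H.edgeFinset, 0 < x e) {A : Finset (Sym2 C)}
    (hA : A ⊆ H.edgeFinset) : 0 < weight x A :=
  prod_pos fun e he => hx0 e (hA he)

theorem weight_le_one (hx0 : ∀ e ∈ H.edgeFinset, 0 < x e) (hx1 : ∀ e ∈ H.edgeFinset, x e ≤ 1)
    {A : Finset (Sym2 C)} (hA : A ⊆ H.edgeFinset) : weight x A ≤ 1 :=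
  prod_le_one (fun e he => (hx0 e (hA he)).le) fun e he => hx1 e (hA he)

theorem oddSum_empty_pos (hx0 : ∀ e ∈ H.edgeFinset, 0 < x e) : 0 < oddSum H x ∅ := by
  refine sum_pos (fun A hA => ?_) ⟨∅, by simp⟩
  exact weight_pos hx0 (mem_powerset.1 (mem_filter.1 hA).1)

theorem symmDiff_subset {α : Type*} [DecidableEq α] {s t u : Finset α} (hs : s ⊆ u) (ht : t ⊆ u) :
    s ∆ t ⊆ u := by
  intro a ha
  rcases mem_symmDiff.1 ha with h | h
  exacts [hs h.1, ht h.1]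

theorem sum_weight_symmDiff {T : Finset (Sym2 C)} (hT : T ⊆ H.edgeFinset) (W : Finset C) :
    ∑ D ∈ H.edgeFinset.powerset with odd D = W, weight x (T ∆ D) = oddSum H x (odd T ∆ W) := by
  refine sum_nbij' (fun D => T ∆ D) (fun D => T ∆ D) ?_ ?_ ?_ ?_ ?_
  · intro D hD
    rw [mem_filter, mem_powerset] at hD ⊢
    exact ⟨symmDiff_subset hT hD.1, by rw [odd_symmDiff, hD.2]⟩
  · intro D hD
    rw [mem_filter, mem_powerset] at hD ⊢
    exact ⟨symmDiff_subset hT hD.1, by rw [odd_symmDiff, hD.2, symmDiff_symmDiff_cancel_left]⟩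
  · intro D _
    exact symmDiff_symmDiff_cancel_left _ _
  · intro D _
    exact symmDiff_symmDiff_cancel_left _ _
  · intros; rfl

/-! ### The worm states -/

variable (H)

/-- The set of worm states, as a finset of edge sets. -/
def states : Finset (Finset (Sym2 C)) :=
  {A ∈ H.edgeFinset.powerset | #(odd A) = 0 ∨ #(odd A) = 2}

/-- The factor `ξ` of the worm weight. -/
def xi (A : Finset (Sym2 C)) : ℝ := if #(odd A) = 0 then (Fintype.card C : ℝ) else 2

variable {H}

theorem mem_states {A : Finset (Sym2 C)} :
    A ∈ states H ↔ A ⊆ H.edgeFinset ∧ (#(odd A) = 0 ∨ #(odd A) = 2) := by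
  simp [states]

theorem sum_states (g : Finset (Sym2 C) → ℝ) : ∑ A ∈ states H, g A = ∑ A : State H, g A.1 :=
  sum_subtype (states H) (fun _ => mem_states) g

theorem xi_nonneg (A : Finset (Sym2 C)) : 0 ≤ xi A := by
  rw [xi]; split_ifs <;> positivity

/-- Group D by its odd set W; translation by T turns each group into `oddSum H x (odd T ∆ W)`, at
most `oddSum H x ∅`. With m vertices, the coefficients total m + 2·m(m − 1)/2 = m². -/
theorem sum_xi_mul_weight_symmDiff_le (hx0 : ∀ e ∈ H.edgeFinset, 0 < x e)
    (hx1 : ∀ e ∈ H.edgeFinset, x e ≤ 1) {T : Finset (Sym2 C)} (hT : T ⊆ H.edgeFinset) :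
    ∑ D ∈ states H, xi D * weight x (T ∆ D) ≤ (Fintype.card C : ℝ) ^ 2 * oddSum H x ∅ := by
  have hsplit : ∑ D ∈ states H, xi D * weight x (T ∆ D)
      = ∑ D ∈ H.edgeFinset.powerset with odd D ∈ powersetCard 0 univ,
          xi D * weight x (T ∆ D)
        + ∑ D ∈ H.edgeFinset.powerset with odd D ∈ powersetCard 2 univ,
          xi D * weight x (T ∆ D) := by
    rw [states, filter_or, sum_union]
    · simp [mem_powersetCard]
    · rw [disjoint_filter]
      omega
  have hfib (k : ℕ) : ∑ D ∈ H.edgeFinset.powerset with odd D ∈ powersetCard k univ,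
        xi D * weight x (T ∆ D)
      = ∑ W ∈ powersetCard k univ, (if k = 0 then (Fintype.card C : ℝ) else 2)
          * oddSum H x (odd T ∆ W) := by
    rw [← sum_fiberwise_of_maps_to (g := odd) (t := powersetCard k univ)
      fun D hD => (mem_filter.1 hD).2]
    refine sum_congr rfl fun W hW => ?_
    rw [← sum_weight_symmDiff hT, mul_sum, filter_filter]
    have hWk := (mem_powersetCard.1 hW).2
    refine sum_congr ?_ fun D hD => ?_
    · ext D
      simp only [mem_filter]
      constructor
      · rintro ⟨h, -, h'⟩
        exact ⟨h, h'⟩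
      · rintro ⟨h, h'⟩
        exact ⟨h, h' ▸ hW, h'⟩
    · rw [xi, (mem_filter.1 hD).2, hWk]
  have hle (k : ℕ) : ∑ W ∈ powersetCard k univ, (if k = 0 then (Fintype.card C : ℝ) else 2)
          * oddSum H x (odd T ∆ W)
      ≤ ((Fintype.card C).choose k : ℝ) * ((if k = 0 then (Fintype.card C : ℝ) else 2)
          * oddSum H x ∅) := by
    refine (sum_le_card_nsmul _ _ _ fun W _ =>
      mul_le_mul_of_nonneg_left (oddSum_le hx0 hx1 _) ?_).trans_eq ?_
    · split_ifs <;> positivity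
    · rw [card_powersetCard, card_univ, nsmul_eq_mul]
  rw [hsplit, hfib, hfib]
  refine (add_le_add (hle 0) (hle 2)).trans_eq ?_
  rw [Nat.cast_choose_two]
  simp
  ring

/-! ### Unwinding -/

theorem symmDiff_singleton_of_mem {α : Type*} [DecidableEq α] {A : Finset α} {e : α}
    (h : e ∈ A) : A ∆ {e} = A.erase e := by
  ext a; simp only [mem_symmDiff, mem_singleton, mem_erase]; grind

theorem symmDiff_singleton_of_notMem {α : Type*} [DecidableEq α] {A : Finset α} {e : α}
    (h : e ∉ A) : A ∆ {e} = insert e A := by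
  ext a; simp only [mem_symmDiff, mem_singleton, mem_insert]; grind

/-- Deleting an edge at an odd vertex moves that odd vertex to the other end, or cancels the pair.
If there is no odd vertex, deleting any edge creates a pair. -/
theorem exists_erase_mem_states {D : Finset (Sym2 C)} (hD : D ∈ states H) (hne : D.Nonempty) :
    ∃ e ∈ D, D.erase e ∈ states H := by
  rw [mem_states] at hD
  obtain ⟨hDE, hD⟩ := hD
  have key (u v : C) (he : s(u, v) ∈ D) (hu : odd D = ∅ ∨ u ∈ odd D) :
      D.erase s(u, v) ∈ states H := by
    have huv : u ≠ v := by
      have := hDE he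
      rw [SimpleGraph.mem_edgeFinset, SimpleGraph.mem_edgeSet] at this
      exact this.ne
    rw [mem_states]
    refine ⟨(erase_subset _ _).trans hDE, ?_⟩
    rw [← symmDiff_singleton_of_mem he, odd_symmDiff, odd_singleton u v]
    rcases hu with hu | hu
    · right
      rw [hu, ← bot_eq_empty, bot_symmDiff, card_pair huv]
    · have h0 : #(odd D) = 2 := by
        rcases hD with h | h
        · rw [card_eq_zero] at h
          simp [h] at hu
        · exact h
      obtain ⟨w, hw⟩ : ∃ w, odd D = {u, w} ∧ u ≠ w := by
        obtain ⟨a, b, hab, h⟩ := card_eq_two.1 h0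
        rw [h, mem_insert, mem_singleton] at hu
        rcases hu with rfl | rfl
        · exact ⟨b, h, hab⟩
        · exact ⟨a, by rw [h, pair_comm], hab.symm⟩
      rw [hw.1]
      by_cases hwv : w = v
      · left
        rw [hwv, symmDiff_self]
        simp
      · right
        have : ({u, w} : Finset C) ∆ {u, v} = {w, v} := by
          ext a
          simp only [mem_symmDiff, mem_insert, mem_singleton]
          have := hw.2
          grind
        rw [this, card_pair hwv]
  by_cases h : odd D = ∅
  · obtain ⟨e, he⟩ := hne
    induction e using Sym2.ind with
    | _ u v => exact ⟨_, he, key u v he (Or.inl h)⟩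
  · obtain ⟨u, hu⟩ := nonempty_iff_ne_empty.2 h
    have hpos := (mem_odd.1 hu).pos
    obtain ⟨e, he⟩ := card_pos.1 hpos
    rw [mem_filter] at he
    obtain ⟨v, rfl⟩ := he.2
    exact ⟨_, he.1, key u v he.1 (Or.inr hu)⟩

/-- `R e` is what is left of D just before e is deleted. The order of deletion is never recorded:
later steps need only that functions telescope along it. -/
theorem exists_unwinding {D : Finset (Sym2 C)} (hD : D ∈ states H) :
    ∃ R : Sym2 C → Finset (Sym2 C),
      (∀ e ∈ D, e ∈ R e ∧ R e ⊆ D ∧ R e ∈ states H ∧ (R e).erase e ∈ states H) ∧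
      ∀ f : Finset (Sym2 C) → ℝ, ∑ e ∈ D, (f (R e) - f ((R e).erase e)) = f D - f ∅ := by
  induction D using Finset.strongInduction with
  | H D ih =>
    rcases D.eq_empty_or_nonempty with rfl | hne
    · exact ⟨fun _ => ∅, by simp, by simp⟩
    · obtain ⟨e₀, he₀, hD'⟩ := exists_erase_mem_states hD hne
      obtain ⟨R, hR, hsum⟩ := ih _ (erase_ssubset he₀) hD'
      -- The edge `e₀` goes first, when all of D is present.
      refine ⟨Function.update R e₀ D, fun e he => ?_, fun f => ?_⟩
      · by_cases h : e = e₀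
        · subst h
          simp only [Function.update_self]
          exact ⟨he, Subset.rfl, hD, hD'⟩
        · rw [Function.update_of_ne h]
          obtain ⟨h1, h2, h3⟩ := hR e (mem_erase.2 ⟨h, he⟩)
          exact ⟨h1, h2.trans (erase_subset _ _), h3⟩
      · rw [← add_sum_erase _ _ he₀, Function.update_self]
        have : ∑ e ∈ D.erase e₀, (f (Function.update R e₀ D e)
              - f ((Function.update R e₀ D e).erase e))
            = ∑ e ∈ D.erase e₀, (f (R e) - f ((R e).erase e)) :=
          sum_congr rfl fun e he => by rw [Function.update_of_ne (ne_of_mem_erase he)]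
        rw [this, hsum]
        ring

/-- An edge of D lies in exactly one of S and S ∆ D, an edge of S \ D in both. -/
theorem weight_mul_weight_symmDiff (S D : Finset (Sym2 C)) :
    weight x (S ∆ D) * weight x S = weight x D * weight x (S \ D) ^ 2 := by
  have h1 : weight x (S ∆ D) = weight x (S \ D) * weight x (D \ S) :=
    prod_union disjoint_sdiff_sdiff
  have h2 : weight x S = weight x (S \ D) * weight x (S ∩ D) := by
    rw [weight, weight, weight, mul_comm, prod_inter_mul_prod_sdiff]
  have h3 : weight x D = weight x (D \ S) * weight x (S ∩ D) := by
    rw [weight, weight, weight, mul_comm, inter_comm, prod_inter_mul_prod_sdiff]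
  rw [h1, h2, h3]
  ring

/-- The product depends on F only through F \ D, which is unaffected by a change inside D. This is
the encoding identity of the canonical paths. -/
theorem weight_mul_weight_symmDiff_of_subset (F : Finset (Sym2 C)) {R D : Finset (Sym2 C)}
    (hR : R ⊆ D) : weight x (F ∆ D) * weight x F
      = weight x (F ∆ R) * weight x ((F ∆ R) ∆ D) := by
  rw [weight_mul_weight_symmDiff, mul_comm (weight x (F ∆ R)), weight_mul_weight_symmDiff]
  congr 3
  ext a
  simp only [mem_sdiff, mem_symmDiff]
  have := @hR a
  tauto

end Worm

namespace Worm

variable {C : Type*} [Fintype C] [DecidableEq C] {H : SimpleGraph C} [DecidableRel H.Adj]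
  {x : Sym2 C → ℝ}

/-! ### Transition probabilities -/

theorem degree_pos_of_adj {u v : C} (h : H.Adj u v) : (0 : ℝ) < H.degree u := by
  rw [Nat.cast_pos, SimpleGraph.degree_pos_iff_exists_adj]
  exact ⟨v, h⟩

theorem weight_insert_eq (x : Sym2 C → ℝ) (A : Finset (Sym2 C)) (e : Sym2 C) :
    weight x A * (if e ∉ A then x e else 1) = weight x (insert e A) := by
  by_cases h : e ∈ A
  · simp [h]
  · rw [if_pos h, weight, weight, prod_insert h, mul_comm]

theorem insert_symmDiff_singleton {α : Type*} [DecidableEq α] (A : Finset α) (e : α) :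
    insert e (A ∆ {e}) = insert e A := by
  ext a; simp only [mem_symmDiff, mem_singleton, mem_insert]; grind

theorem edge_mem {u v : C} (h : H.Adj u v) : s(u, v) ∈ H.edgeFinset := by
  rwa [SimpleGraph.mem_edgeFinset, SimpleGraph.mem_edgeSet]

theorem moveProb_nonneg (hx0 : ∀ e ∈ H.edgeFinset, 0 < x e) (A : Finset (Sym2 C)) {u v : C}
    (h : H.Adj u v) : 0 ≤ moveProb H x A u v := by
  have := hx0 _ (edge_mem h)
  unfold moveProb
  split_ifs <;> positivity

theorem moveProb_le (hx0 : ∀ e ∈ H.edgeFinset, 0 < x e) (hx1 : ∀ e ∈ H.edgeFinset, x e ≤ 1)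
    (A : Finset (Sym2 C)) {u v : C} (h : H.Adj u v) :
    moveProb H x A u v ≤ (if #(odd A) = 0 then 1 / (2 * (Fintype.card C : ℝ))
      else if u ∈ odd A then 1 / 4 else 0) * (1 / H.degree u) := by
  have h0 := hx0 _ (edge_mem h)
  have h1 := hx1 _ (edge_mem h)
  have hd := degree_pos_of_adj h
  have hle : (if s(u, v) ∉ A then x s(u, v) else 1) ≤ 1 := by split_ifs <;> simp [h1]
  unfold moveProb
  by_cases hA : #(odd A) = 0
  · simp only [hA, if_true]
    exact mul_le_mul_of_nonneg_right (mul_le_of_le_one_left (by positivity) hle) (by positivity)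
  · simp only [hA, if_false]
    by_cases hu : u ∈ odd A
    · simp only [hu, if_true]
      by_cases hB : #(odd (A ∆ {s(u, v)})) = 0
      · rw [if_pos hB]
        exact mul_le_mul_of_nonneg_right (mul_le_of_le_one_left (by positivity) hle)
          (by positivity)
      · rw [if_neg hB]
        calc _ ≤ 1 * (1 / (4 * (H.degree u : ℝ))) :=
              mul_le_mul_of_nonneg_right (min_le_left _ _) (by positivity)
          _ = _ := by field_simp
    · simp [hu]

theorem offDiagProb_nonneg (hx0 : ∀ e ∈ H.edgeFinset, 0 < x e) (A B : State H) :
    0 ≤ offDiagProb H x A B :=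
  sum_nonneg fun p hp => moveProb_nonneg hx0 _ (mem_filter.1 hp).2.1

/-- Bound acceptance by 1. Choosing a neighbour then has total probability at most 1, and choosing
the vertex has mass 1/2: m vertices at 1/(2m), or two odd vertices at 1/4. -/
theorem sum_offDiagProb_le (hx0 : ∀ e ∈ H.edgeFinset, 0 < x e)
    (hx1 : ∀ e ∈ H.edgeFinset, x e ≤ 1) (A : State H) (s : Finset (State H)) :
    ∑ B ∈ s, offDiagProb H x A B ≤ 1 / 2 := by
  set c : C → ℝ := fun u => if #(odd A.1) = 0 then 1 / (2 * (Fintype.card C : ℝ))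
      else if u ∈ odd A.1 then 1 / 4 else 0 with hc
  have hc0 (u : C) : 0 ≤ c u := by
    simp only [hc]; split_ifs <;> positivity
  have h1 : ∑ B ∈ s, offDiagProb H x A B
      ≤ ∑ p : C × C with H.Adj p.1 p.2, moveProb H x A.1 p.1 p.2 := by
    calc ∑ B ∈ s, offDiagProb H x A B
        ≤ ∑ B, offDiagProb H x A B :=
          sum_le_sum_of_subset_of_nonneg (subset_univ _) fun B _ _ => offDiagProb_nonneg hx0 A B
      _ = ∑ p : C × C with H.Adj p.1 p.2, ∑ B : State H with B.1 = A.1 ∆ {s(p.1, p.2)},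
            moveProb H x A.1 p.1 p.2 := by
          simp only [offDiagProb, sum_filter]
          rw [sum_comm]
          refine sum_congr rfl fun p _ => ?_
          split_ifs with hp <;> simp [hp]
      _ ≤ _ := by
          refine sum_le_sum fun p hp => ?_
          rw [sum_const, nsmul_eq_mul]
          -- An oriented edge has at most one target state.
          refine mul_le_of_le_one_left (moveProb_nonneg hx0 _ (mem_filter.1 hp).2) ?_
          rw [Nat.cast_le_one, card_le_one]
          intro B hB B' hB'
          exact Subtype.ext ((mem_filter.1 hB).2.trans (mem_filter.1 hB').2.symm)
  have h2 : ∑ p : C × C with H.Adj p.1 p.2, moveProb H x A.1 p.1 p.2 ≤ ∑ u, c u := by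
    calc _ ≤ ∑ p : C × C with H.Adj p.1 p.2, c p.1 * (1 / H.degree p.1) :=
          sum_le_sum fun p hp => moveProb_le hx0 hx1 A.1 (mem_filter.1 hp).2
      _ = ∑ u, ∑ v with H.Adj u v, c u * (1 / H.degree u) := by
          rw [sum_filter, Fintype.sum_prod_type]
          simp only [sum_filter]
      _ ≤ ∑ u, c u := by
          refine sum_le_sum fun u _ => ?_
          rw [sum_const, nsmul_eq_mul, ← H.neighborFinset_eq_filter, H.card_neighborFinset_eq_degree]
          by_cases hd : (H.degree u : ℝ) = 0
          · rw [hd, zero_mul]; exact hc0 u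
          · field_simp
            exact le_refl _
  refine h1.trans (h2.trans ?_)
  simp only [hc]
  rcases A.2.2 with h | h
  · simp only [h, if_true, sum_const, card_univ, nsmul_eq_mul]
    by_cases hN : (Fintype.card C : ℝ) = 0
    · rw [hN]; norm_num
    · field_simp
      exact le_refl _
  · simp only [h, OfNat.ofNat_ne_zero, if_false]
    rw [← sum_filter, sum_const, filter_univ_mem, h]
    norm_num

theorem transition_of_ne {A B : State H} (h : A ≠ B) :
    transition H x A B = offDiagProb H x A B := by
  simp [transition, h]

theorem transition_nonneg (hx0 : ∀ e ∈ H.edgeFinset, 0 < x e)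
    (hx1 : ∀ e ∈ H.edgeFinset, x e ≤ 1) (A B : State H) : 0 ≤ transition H x A B := by
  simp only [transition, Matrix.of_apply]
  split_ifs
  · linarith [sum_offDiagProb_le hx0 hx1 A (univ.erase A)]
  · exact offDiagProb_nonneg hx0 A B

theorem half_le_transition_self (hx0 : ∀ e ∈ H.edgeFinset, 0 < x e)
    (hx1 : ∀ e ∈ H.edgeFinset, x e ≤ 1) (A : State H) : 1 / 2 ≤ transition H x A A := by
  simp only [transition, Matrix.of_apply, if_true]
  linarith [sum_offDiagProb_le hx0 hx1 A (univ.erase A)]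

theorem sum_transition (x : Sym2 C → ℝ) (A : State H) : ∑ B, transition H x A B = 1 := by
  rw [← add_sum_erase _ _ (mem_univ A),
    sum_congr rfl fun B hB => transition_of_ne (x := x) (ne_of_mem_erase hB).symm]
  simp [transition]

theorem wormWeight_eq (A : State H) : wormWeight H x A = xi A.1 * weight x A.1 := rfl

/-- The flow of a move from or to a state without odd vertices. -/
theorem wormWeight_mul_moveProb_of_card_eq_zero {A B : State H} {u v : C} (h : H.Adj u v)
    (hB : B.1 = A.1 ∆ {s(u, v)}) (h0 : #(odd A.1) = 0 ∨ #(odd B.1) = 0) :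
    wormWeight H x A * moveProb H x A.1 u v
      = weight x (insert s(u, v) A.1) * (1 / (2 * H.degree u)) := by
  have hd := degree_pos_of_adj h
  rw [← weight_insert_eq, wormWeight_eq]
  -- ξ balances the proposals: m · 1/(2m) on Ω₀ and 2 · 1/4 on Ω₂ are both 1/2.
  by_cases hA : #(odd A.1) = 0
  · have hN : (0 : ℝ) < Fintype.card C := by
      have : Nonempty C := ⟨u⟩
      exact_mod_cast Fintype.card_pos
    simp only [moveProb, xi, hA, if_true]
    field_simp
  · have hB0 : #(odd B.1) = 0 := h0.resolve_left hA
    have hu : u ∈ odd A.1 := by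
      rw [hB, odd_symmDiff, odd_singleton, card_eq_zero, ← bot_eq_empty, symmDiff_eq_bot] at hB0
      rw [hB0]
      simp
    rw [hB] at hB0
    simp only [moveProb, xi, hA, hu, hB0, if_true, if_false]
    generalize (if s(u, v) ∉ A.1 then x s(u, v) else 1) = r
    field_simp
    ring

/-- The flow of a move between states with two odd vertices. -/
theorem wormWeight_mul_moveProb_of_mem {A B : State H} {u v : C} (h : H.Adj u v)
    (hx0 : ∀ e ∈ H.edgeFinset, 0 < x e)
    (hB : B.1 = A.1 ∆ {s(u, v)}) (hA0 : #(odd A.1) ≠ 0) (hB0 : #(odd B.1) ≠ 0)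
    (hu : u ∈ odd A.1) :
    wormWeight H x A * moveProb H x A.1 u v
      = 1 / 2 * min (weight x A.1 / H.degree u) (weight x B.1 / H.degree v) := by
  have hd := degree_pos_of_adj h
  have hd' := degree_pos_of_adj h.symm
  have hw := weight_pos hx0 A.2.1
  have he := hx0 _ (edge_mem h)
  have hBw : weight x B.1
      = weight x A.1 * if s(u, v) ∉ A.1 then x s(u, v) else (x s(u, v))⁻¹ := by
    rw [hB]
    by_cases hm : s(u, v) ∈ A.1
    · rw [if_neg (not_not.2 hm), symmDiff_singleton_of_mem hm, weight, weight,
        ← mul_prod_erase _ _ hm]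
      field_simp
    · rw [if_pos hm, symmDiff_singleton_of_notMem hm, weight, weight, prod_insert hm, mul_comm]
  rw [wormWeight_eq, hBw]
  rw [hB] at hB0
  simp only [moveProb, xi, hA0, hu, hB0, if_true, if_false]
  generalize (if s(u, v) ∉ A.1 then x s(u, v) else (x s(u, v))⁻¹) = r
  have hmin : min (weight x A.1 / H.degree u) (weight x A.1 * r / H.degree v)
      = weight x A.1 / H.degree u * min 1 (H.degree u / H.degree v * r) := by
    rw [mul_min_of_nonneg _ _ (by positivity), mul_one]
    congr 1
    field_simp
  rw [hmin]
  field_simp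
  ring

theorem moveProb_eq_zero {A : Finset (Sym2 C)} {u v : C} (hA0 : #(odd A) ≠ 0)
    (hu : u ∉ odd A) : moveProb H x A u v = 0 := by
  simp [moveProb, hA0, hu]

/-- Along a move between states with two odd vertices exactly one end of the edge is odd. -/
theorem mem_odd_iff_of_card_ne_zero {A B : State H} {u v : C} (h : H.Adj u v)
    (hB : B.1 = A.1 ∆ {s(u, v)}) (hA0 : #(odd A.1) ≠ 0) (hB0 : #(odd B.1) ≠ 0) :
    u ∈ odd A.1 ↔ v ∉ odd A.1 := by
  have hA2 := A.2.2.resolve_left hA0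
  have hB2 := B.2.2.resolve_left hB0
  rw [hB, odd_symmDiff, odd_singleton] at hB2
  have huv := h.ne
  have hp : #({u, v} : Finset C) = 2 := card_pair huv
  have h1 : #(odd A.1 ∆ {u, v}) = #(odd A.1 \ {u, v}) + #({u, v} \ odd A.1) :=
    card_union_of_disjoint disjoint_sdiff_sdiff
  have h2 := card_sdiff_add_card_inter (odd A.1) {u, v}
  have h3 := card_sdiff_add_card_inter {u, v} (odd A.1)
  rw [inter_comm] at h3
  -- Both odd sets have size 2, so 2 + 2 − 2·#(intersection) = 2.
  have hi : #(odd A.1 ∩ {u, v}) = 1 := by omega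
  constructor
  · intro hu hv
    have : odd A.1 ∩ {u, v} = {u, v} := inter_eq_right.2 (by simp [insert_subset_iff, hu, hv])
    rw [this] at hi
    omega
  · intro hv
    by_contra hu
    have : odd A.1 ∩ {u, v} = ∅ := by
      rw [← disjoint_iff_inter_eq_empty]
      simp [hu, hv]
    rw [this] at hi
    simp at hi

theorem symmDiff_singleton_eq_comm {α : Type*} [DecidableEq α] {A B : Finset α} {e : α} :
    B = A ∆ {e} ↔ A = B ∆ {e} := by
  constructor <;> rintro rfl <;> rw [symmDiff_symmDiff_cancel_right]

/-- If A or B is even, each oriented edge already carries symmetric flow. Otherwise a move carries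
an odd end from u to v, and its reverse uses the opposite orientation; hence the bijection
`Prod.swap`. -/
theorem wormWeight_mul_offDiagProb_comm (hx0 : ∀ e ∈ H.edgeFinset, 0 < x e) (A B : State H) :
    wormWeight H x A * offDiagProb H x A B = wormWeight H x B * offDiagProb H x B A := by
  rw [offDiagProb, offDiagProb, mul_sum, mul_sum]
  by_cases h0 : #(odd A.1) = 0 ∨ #(odd B.1) = 0
  · refine sum_congr (filter_congr fun p _ => by
      rw [symmDiff_singleton_eq_comm (A := A.1)]) fun p hp => ?_
    obtain ⟨hp1, hp2⟩ := (mem_filter.1 hp).2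
    rw [← symmDiff_singleton_eq_comm] at hp2
    rw [wormWeight_mul_moveProb_of_card_eq_zero hp1 hp2 h0,
      wormWeight_mul_moveProb_of_card_eq_zero hp1 (symmDiff_singleton_eq_comm.1 hp2) h0.symm,
      hp2, insert_symmDiff_singleton]
  · rw [not_or] at h0
    refine sum_nbij' Prod.swap Prod.swap ?_ ?_ (fun _ _ => rfl) (fun _ _ => rfl) ?_
    · intro p hp
      simp only [mem_filter, mem_univ, true_and, Prod.fst_swap, Prod.snd_swap] at hp ⊢
      exact ⟨hp.1.symm, by rw [Sym2.eq_swap]; exact symmDiff_singleton_eq_comm.1 hp.2⟩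
    · intro p hp
      simp only [mem_filter, mem_univ, true_and, Prod.fst_swap, Prod.snd_swap] at hp ⊢
      exact ⟨hp.1.symm, by rw [Sym2.eq_swap]; exact symmDiff_singleton_eq_comm.1 hp.2⟩
    · rintro ⟨u, v⟩ hp
      simp only [mem_filter, mem_univ, true_and, Prod.fst_swap, Prod.snd_swap] at hp ⊢
      obtain ⟨hadj, hB⟩ := hp
      have hB' : A.1 = B.1 ∆ {s(v, u)} := by
        rw [Sym2.eq_swap]; exact symmDiff_singleton_eq_comm.1 hB
      have hv : v ∈ odd B.1 ↔ v ∉ odd A.1 := by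
        rw [hB, odd_symmDiff, odd_singleton]
        simp [mem_symmDiff]
      have hu := mem_odd_iff_of_card_ne_zero hadj hB h0.1 h0.2
      by_cases hmem : u ∈ odd A.1
      · rw [wormWeight_mul_moveProb_of_mem hadj hx0 hB h0.1 h0.2 hmem,
          wormWeight_mul_moveProb_of_mem hadj.symm hx0 hB' h0.2 h0.1 (hv.2 (hu.1 hmem)), min_comm]
      · rw [moveProb_eq_zero h0.1 hmem, moveProb_eq_zero h0.2 (by tauto), mul_zero, mul_zero]

theorem wormWeight_mul_transition_comm (hx0 : ∀ e ∈ H.edgeFinset, 0 < x e) (A B : State H) :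
    wormWeight H x A * transition H x A B = wormWeight H x B * transition H x B A := by
  by_cases h : A = B
  · rw [h]
  · rw [transition_of_ne h, transition_of_ne (Ne.symm h), wormWeight_mul_offDiagProb_comm hx0]

theorem weight_insert_le (hx0 : ∀ e ∈ H.edgeFinset, 0 < x e)
    (hx1 : ∀ e ∈ H.edgeFinset, x e ≤ 1) {A : Finset (Sym2 C)} (hA : A ⊆ H.edgeFinset)
    {e : Sym2 C} (he : e ∈ H.edgeFinset) : weight x (insert e A) ≤ weight x A := by
  rw [← weight_insert_eq]
  refine mul_le_of_le_one_right (weight_pos hx0 hA).le ?_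
  split_ifs
  exacts [le_rfl, hx1 e he]

/-- One orientation of e suffices. Its flow is half a weight over a degree, or half a minimum of two
such quotients; degrees are at most the number of vertices, and adding e cannot raise a weight. -/
theorem weight_insert_le_transition (hx0 : ∀ e ∈ H.edgeFinset, 0 < x e)
    (hx1 : ∀ e ∈ H.edgeFinset, x e ≤ 1) {A B : State H} {e : Sym2 C} (he : e ∈ H.edgeFinset)
    (hB : B.1 = A.1 ∆ {e}) :
    weight x (insert e A.1) ≤ 2 * Fintype.card C * (wormWeight H x A * transition H x A B) := by
  have hAB : A ≠ B := by
    rintro rfl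
    have := (mem_symmDiff (s := A.1) (t := {e}) (a := e))
    rw [← hB] at this
    simp at this
  have hins : insert e B.1 = insert e A.1 := by rw [hB, insert_symmDiff_singleton]
  have hpos : 0 < weight x (insert e A.1) :=
    weight_pos hx0 (insert_subset he A.2.1)
  have hxi : 0 ≤ wormWeight H x A := by
    rw [wormWeight_eq]; exact mul_nonneg (xi_nonneg _) (weight_pos hx0 A.2.1).le
  have hdeg (u : C) : (H.degree u : ℝ) ≤ Fintype.card C := by
    exact_mod_cast (H.degree_lt_card_verts u).le
  obtain ⟨u, v, rfl, hterm⟩ : ∃ u v, e = s(u, v) ∧ weight x (insert e A.1)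
      ≤ 2 * Fintype.card C * (wormWeight H x A * moveProb H x A.1 u v) := by
    induction e using Sym2.ind with
    | _ u v =>
      have hadj : H.Adj u v := by
        rwa [SimpleGraph.mem_edgeFinset, SimpleGraph.mem_edgeSet] at he
      have key (u v : C) (hadj : H.Adj u v) (he : s(u, v) ∈ H.edgeFinset)
          (hB : B.1 = A.1 ∆ {s(u, v)})
          (hins : insert s(u, v) B.1 = insert s(u, v) A.1)
          (hpos : 0 < weight x (insert s(u, v) A.1))
          (hu : #(odd A.1) = 0 ∨ #(odd B.1) = 0 ∨ u ∈ odd A.1) :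
          weight x (insert s(u, v) A.1)
            ≤ 2 * Fintype.card C * (wormWeight H x A * moveProb H x A.1 u v) := by
        have hd := degree_pos_of_adj hadj
        have hd' := degree_pos_of_adj hadj.symm
        by_cases h0 : #(odd A.1) = 0 ∨ #(odd B.1) = 0
        · rw [wormWeight_mul_moveProb_of_card_eq_zero hadj hB h0]
          have : 1 ≤ (Fintype.card C : ℝ) / H.degree u := (one_le_div hd).2 (hdeg u)
          calc _ ≤ weight x (insert s(u, v) A.1) * (Fintype.card C / H.degree u) :=
                le_mul_of_one_le_right hpos.le this
            _ = _ := by field_simp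
        · rw [not_or] at h0
          rw [wormWeight_mul_moveProb_of_mem hadj hx0 hB h0.1 h0.2 (by tauto)]
          have hN : (0 : ℝ) < Fintype.card C := hd.trans_le (hdeg u)
          have h1 : weight x (insert s(u, v) A.1) / Fintype.card C
              ≤ weight x A.1 / H.degree u :=
            div_le_div₀ (weight_pos hx0 A.2.1).le (weight_insert_le hx0 hx1 A.2.1 he) hd (hdeg u)
          have h2 : weight x (insert s(u, v) A.1) / Fintype.card C
              ≤ weight x B.1 / H.degree v := by
            rw [← hins]
            exact div_le_div₀ (weight_pos hx0 B.2.1).le (weight_insert_le hx0 hx1 B.2.1 he)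
              hd' (hdeg v)
          calc weight x (insert s(u, v) A.1)
              = Fintype.card C * (weight x (insert s(u, v) A.1) / Fintype.card C) := by
                field_simp
            _ ≤ Fintype.card C * min (weight x A.1 / H.degree u) (weight x B.1 / H.degree v) :=
                mul_le_mul_of_nonneg_left (le_min h1 h2) hN.le
            _ = _ := by ring
      by_cases h0 : #(odd A.1) = 0 ∨ #(odd B.1) = 0 ∨ u ∈ odd A.1
      · exact ⟨u, v, rfl, key u v hadj he hB hins hpos h0⟩
      -- Here the odd end is v, so the opposite orientation is used.
      · push Not at h0
        have hv := mem_odd_iff_of_card_ne_zero hadj hB h0.1 h0.2.1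
        have hs : s(u, v) = s(v, u) := Sym2.eq_swap
        refine ⟨v, u, hs, ?_⟩
        rw [hs] at he hB hins hpos ⊢
        exact key v u hadj.symm he hB hins hpos (by tauto)
  refine hterm.trans (mul_le_mul_of_nonneg_left
    (mul_le_mul_of_nonneg_left ?_ hxi) (by positivity))
  rw [transition_of_ne hAB, offDiagProb]
  refine single_le_sum (f := fun p : C × C => moveProb H x A.1 p.1 p.2)
    (fun p hp => moveProb_nonneg hx0 _ (mem_filter.1 hp).2.1)
    (a := (u, v)) ?_
  simp only [mem_filter, mem_univ, true_and]
  exact ⟨by rwa [SimpleGraph.mem_edgeFinset, SimpleGraph.mem_edgeSet] at he, hB⟩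

end Worm

namespace Worm

variable {C : Type*} [Fintype C] [DecidableEq C] {H : SimpleGraph C} [DecidableRel H.Adj]
  {x : Sym2 C → ℝ}

/-! ### Poincaré inequality by canonical paths -/

/-- Telescope g from F ∆ D to F and apply Cauchy–Schwarz; the path has #D ≤ #E steps. -/
theorem sq_sub_le_sum_unwinding {D : Finset (Sym2 C)} (hD : D ⊆ H.edgeFinset)
    {R : Sym2 C → Finset (Sym2 C)} (hR : ∀ e ∈ D, e ∈ R e)
    (hsum : ∀ f : Finset (Sym2 C) → ℝ, ∑ e ∈ D, (f (R e) - f ((R e).erase e)) = f D - f ∅)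
    (g : Finset (Sym2 C) → ℝ) (F : Finset (Sym2 C)) :
    (g (F ∆ D) - g F) ^ 2
      ≤ #H.edgeFinset * ∑ e ∈ D, (g (F ∆ R e) - g ((F ∆ R e) ∆ {e})) ^ 2 := by
  have h1 : g (F ∆ D) - g F = ∑ e ∈ D, (g (F ∆ R e) - g ((F ∆ R e) ∆ {e})) := by
    have h := hsum fun A => g (F ∆ A)
    simp only [← bot_eq_empty, symmDiff_bot] at h
    rw [← h]
    exact sum_congr rfl fun e he => by
      rw [symmDiff_assoc, symmDiff_singleton_of_mem (hR e he)]
  rw [h1]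
  refine sq_sum_le_card_mul_sum_sq.trans (mul_le_mul_of_nonneg_right ?_
    (sum_nonneg fun _ _ => sq_nonneg _))
  exact_mod_cast card_le_card hD

/-- For fixed D and e, the state A = F ∆ R e determines F, so each transition is charged at most
once. The path remains in Ω because translating by an even F preserves odd sets. -/
theorem sum_flow_le (hx0 : ∀ e ∈ H.edgeFinset, 0 < x e) {D : Finset (Sym2 C)}
    (hD : D ∈ states H) (g : Finset (Sym2 C) → ℝ) :
    ∑ F ∈ H.edgeFinset.powerset with odd F = ∅,
        xi D * (weight x (F ∆ D) * weight x F) * (g (F ∆ D) - g F) ^ 2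
      ≤ #H.edgeFinset * ∑ e ∈ H.edgeFinset, ∑ A ∈ states H with A ∆ {e} ∈ states H,
          xi D * (weight x (insert e A) * weight x (insert e A ∆ D))
            * (g A - g (A ∆ {e})) ^ 2 := by
  obtain ⟨R, hR, hsum⟩ := exists_unwinding hD
  have hDE := (mem_states.1 hD).1
  set term : Sym2 C → Finset (Sym2 C) → ℝ := fun e A =>
    xi D * (weight x (insert e A) * weight x (insert e A ∆ D)) * (g A - g (A ∆ {e})) ^ 2
    with hterm
  have hterm0 {e : Sym2 C} (he : e ∈ H.edgeFinset) {A : Finset (Sym2 C)} (hA : A ∈ states H) :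
      0 ≤ term e A := by
    have h1 : insert e A ⊆ H.edgeFinset := insert_subset he (mem_states.1 hA).1
    exact mul_nonneg (mul_nonneg (xi_nonneg _) (mul_nonneg (weight_pos hx0 h1).le
      (weight_pos hx0 (symmDiff_subset h1 hDE)).le)) (sq_nonneg _)
  -- The larger set of the transition is F ∆ R' with R' either `R e` or `(R e).erase e`, both inside
  -- D.
  have hweight {e : Sym2 C} (he : e ∈ D) (F : Finset (Sym2 C)) :
      weight x (F ∆ D) * weight x F
        = weight x (insert e (F ∆ R e)) * weight x (insert e (F ∆ R e) ∆ D) := by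
    obtain ⟨h1, h2, -⟩ := hR e he
    by_cases h : e ∈ F ∆ R e
    · rw [insert_eq_of_mem h]
      exact weight_mul_weight_symmDiff_of_subset F h2
    · rw [← symmDiff_singleton_of_notMem h, symmDiff_assoc, symmDiff_singleton_of_mem h1]
      exact weight_mul_weight_symmDiff_of_subset F ((erase_subset _ _).trans h2)
  calc _ ≤ ∑ F ∈ H.edgeFinset.powerset with odd F = ∅,
        #H.edgeFinset * ∑ e ∈ D, term e (F ∆ R e) := by
        refine sum_le_sum fun F hF => ?_
        have hFE := mem_powerset.1 (mem_filter.1 hF).1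
        refine (mul_le_mul_of_nonneg_left
          (sq_sub_le_sum_unwinding hDE (fun e he => (hR e he).1) hsum g F)
          (mul_nonneg (xi_nonneg _) (mul_nonneg
            (weight_pos hx0 (symmDiff_subset hFE hDE)).le (weight_pos hx0 hFE).le))).trans_eq ?_
        rw [mul_left_comm, mul_sum]
        congr 1
        exact sum_congr rfl fun e he => by rw [hweight he]
    _ = #H.edgeFinset * ∑ e ∈ D, ∑ F ∈ H.edgeFinset.powerset with odd F = ∅,
          term e (F ∆ R e) := by
        rw [← mul_sum, sum_comm]
    _ ≤ #H.edgeFinset * ∑ e ∈ D, ∑ A ∈ states H with A ∆ {e} ∈ states H, term e A := by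
        refine mul_le_mul_of_nonneg_left (sum_le_sum fun e he => ?_) (Nat.cast_nonneg _)
        obtain ⟨h1, h2, h3, h4⟩ := hR e he
        rw [← sum_image (g := fun F => F ∆ R e) (f := term e)
          fun F _ F' _ h => symmDiff_left_injective _ h]
        refine sum_le_sum_of_subset_of_nonneg ?_
          fun A hA _ => hterm0 (hDE he) (mem_filter.1 hA).1
        intro A hA
        obtain ⟨F, hF, rfl⟩ := mem_image.1 hA
        rw [mem_filter, mem_powerset] at hF
        have hst {S : Finset (Sym2 C)} (hS : S ∈ states H) : F ∆ S ∈ states H := by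
          rw [mem_states] at hS ⊢
          rw [odd_symmDiff, hF.2, ← bot_eq_empty, bot_symmDiff]
          exact ⟨symmDiff_subset hF.1 hS.1, hS.2⟩
        rw [mem_filter, symmDiff_assoc, symmDiff_singleton_of_mem h1]
        exact ⟨hst h3, hst h4⟩
    _ ≤ _ := by
        refine mul_le_mul_of_nonneg_left (sum_le_sum_of_subset_of_nonneg hDE
          fun e he _ => sum_nonneg fun A hA => hterm0 he (mem_filter.1 hA).1) (Nat.cast_nonneg _)

/-- Substitute A = F ∆ D, which preserves ξ as F is even. Summing the bounds over D leaves, at each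
transition, the congestion sum with T = `insert e A`. -/
theorem sum_states_flow_le (hx0 : ∀ e ∈ H.edgeFinset, 0 < x e)
    (hx1 : ∀ e ∈ H.edgeFinset, x e ≤ 1) (g : Finset (Sym2 C) → ℝ) :
    ∑ F ∈ H.edgeFinset.powerset with odd F = ∅, ∑ A ∈ states H,
        xi A * (weight x A * weight x F) * (g A - g F) ^ 2
      ≤ #H.edgeFinset * ((Fintype.card C : ℝ) ^ 2 * oddSum H x ∅)
        * ∑ e ∈ H.edgeFinset, ∑ A ∈ states H with A ∆ {e} ∈ states H,
          weight x (insert e A) * (g A - g (A ∆ {e})) ^ 2 := by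
  have hre : ∀ F ∈ ({F ∈ H.edgeFinset.powerset | odd F = ∅} : Finset (Finset (Sym2 C))),
      ∑ A ∈ states H, xi A * (weight x A * weight x F) * (g A - g F) ^ 2
        = ∑ D ∈ states H, xi D * (weight x (F ∆ D) * weight x F) * (g (F ∆ D) - g F) ^ 2 := by
    intro F hF
    rw [mem_filter, mem_powerset] at hF
    have hodd (S : Finset (Sym2 C)) : odd (F ∆ S) = odd S := by
      rw [odd_symmDiff, hF.2, ← bot_eq_empty, bot_symmDiff]
    have hst {S : Finset (Sym2 C)} (hS : S ∈ states H) : F ∆ S ∈ states H := by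
      rw [mem_states] at hS ⊢
      rw [hodd]
      exact ⟨symmDiff_subset hF.1 hS.1, hS.2⟩
    refine sum_nbij' (fun S => F ∆ S) (fun S => F ∆ S) (fun S hS => hst hS) (fun S hS => hst hS)
      (fun S _ => symmDiff_symmDiff_cancel_left _ _)
      (fun S _ => symmDiff_symmDiff_cancel_left _ _) fun S _ => ?_
    rw [symmDiff_symmDiff_cancel_left, xi, xi, hodd]
  rw [sum_congr rfl hre, sum_comm]
  refine (sum_le_sum fun D hD => sum_flow_le hx0 hD g).trans ?_
  rw [← mul_sum, mul_assoc]
  refine mul_le_mul_of_nonneg_left ?_ (Nat.cast_nonneg _)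
  rw [sum_comm, mul_sum]
  refine sum_le_sum fun e he => ?_
  rw [sum_comm, mul_sum]
  refine sum_le_sum fun A hA => ?_
  have hAe : insert e A ⊆ H.edgeFinset :=
    insert_subset he (mem_states.1 (mem_filter.1 hA).1).1
  calc _ = (∑ D ∈ states H, xi D * weight x (insert e A ∆ D))
        * (weight x (insert e A) * (g A - g (A ∆ {e})) ^ 2) := by
        rw [sum_mul]
        exact sum_congr rfl fun D _ => by ring
    _ ≤ _ := mul_le_mul_of_nonneg_right (sum_xi_mul_weight_symmDiff_le hx0 hx1 hAe)
        (mul_nonneg (weight_pos hx0 hAe).le (sq_nonneg _))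

theorem oddSum_mul_sum_sq_le (hx0 : ∀ e ∈ H.edgeFinset, 0 < x e)
    {g : Finset (Sym2 C) → ℝ} (hg : ∑ A ∈ states H, xi A * weight x A * g A = 0) :
    oddSum H x ∅ * ∑ A ∈ states H, xi A * weight x A * g A ^ 2
      ≤ ∑ F ∈ H.edgeFinset.powerset with odd F = ∅, ∑ A ∈ states H,
        xi A * (weight x A * weight x F) * (g A - g F) ^ 2 := by
  have h1 (F : Finset (Sym2 C)) : ∑ A ∈ states H,
        xi A * (weight x A * weight x F) * (g A - g F) ^ 2
      = weight x F * ∑ A ∈ states H, xi A * weight x A * g A ^ 2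
        + weight x F * g F ^ 2 * ∑ A ∈ states H, xi A * weight x A := by
    -- The vanishing cross term is inserted so that the squares match term by term.
    have : weight x F * ∑ A ∈ states H, xi A * weight x A * g A ^ 2
        + weight x F * g F ^ 2 * ∑ A ∈ states H, xi A * weight x A
        = weight x F * ∑ A ∈ states H, xi A * weight x A * g A ^ 2
        + weight x F * g F ^ 2 * ∑ A ∈ states H, xi A * weight x A
        - 2 * weight x F * g F * ∑ A ∈ states H, xi A * weight x A * g A := by
      rw [hg]; ring
    rw [this, mul_sum, mul_sum, mul_sum, ← sum_add_distrib, ← sum_sub_distrib]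
    exact sum_congr rfl fun A _ => by ring
  rw [oddSum, sum_mul]
  refine sum_le_sum fun F hF => ?_
  rw [h1]
  refine le_add_of_nonneg_right (mul_nonneg (mul_nonneg ?_ (sq_nonneg _))
    (sum_nonneg fun A hA => mul_nonneg (xi_nonneg _) ?_))
  · exact (weight_pos hx0 (mem_powerset.1 (mem_filter.1 hF).1)).le
  · exact (weight_pos hx0 (mem_states.1 hA).1).le

theorem sum_weight_insert_le (hx0 : ∀ e ∈ H.edgeFinset, 0 < x e)
    (hx1 : ∀ e ∈ H.edgeFinset, x e ≤ 1) (g : Finset (Sym2 C) → ℝ) :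
    ∑ e ∈ H.edgeFinset, ∑ A ∈ states H with A ∆ {e} ∈ states H,
        weight x (insert e A) * (g A - g (A ∆ {e})) ^ 2
      ≤ 2 * Fintype.card C * ∑ A : State H, ∑ B : State H,
          wormWeight H x A * transition H x A B * (g A.1 - g B.1) ^ 2 := by
  have hswap : ∑ e ∈ H.edgeFinset, ∑ A ∈ states H with A ∆ {e} ∈ states H,
        weight x (insert e A) * (g A - g (A ∆ {e})) ^ 2
      = ∑ A : State H, ∑ e ∈ H.edgeFinset with A.1 ∆ {e} ∈ states H,
        weight x (insert e A.1) * (g A.1 - g (A.1 ∆ {e})) ^ 2 := by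
    simp only [sum_filter]
    rw [sum_comm, sum_states]
  rw [hswap, mul_sum]
  refine sum_le_sum fun A _ => ?_
  set s : Finset (Sym2 C) := {e ∈ H.edgeFinset | A.1 ∆ {e} ∈ states H} with hs
  set φ : s → State H := fun e => ⟨A.1 ∆ {e.1}, mem_states.1 (mem_filter.1 e.2).2⟩ with hφ
  have hinj : Function.Injective φ := fun e e' h => by
    have := symmDiff_right_injective _ (congrArg Subtype.val h)
    exact Subtype.ext (singleton_injective this)
  set k : State H → ℝ := fun B => wormWeight H x A * transition H x A B * (g A.1 - g B.1) ^ 2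
    with hk
  have hk0 (B : State H) : 0 ≤ k B :=
    mul_nonneg (mul_nonneg (mul_nonneg (xi_nonneg _) (weight_pos hx0 A.2.1).le)
      (transition_nonneg hx0 hx1 _ _)) (sq_nonneg _)
  rw [← sum_coe_sort s]
  calc _ ≤ ∑ e : s, 2 * Fintype.card C * k (φ e) := by
        refine sum_le_sum fun e _ => ?_
        have := weight_insert_le_transition hx0 hx1 (A := A) (B := φ e)
          (mem_filter.1 e.2).1 rfl
        calc _ ≤ 2 * Fintype.card C * (wormWeight H x A * transition H x A (φ e))
              * (g A.1 - g (A.1 ∆ {e.1})) ^ 2 :=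
              mul_le_mul_of_nonneg_right this (sq_nonneg _)
          _ = _ := by rw [hk, mul_assoc]
    _ = 2 * Fintype.card C * ∑ B ∈ univ.image φ, k B := by
        rw [← mul_sum, sum_image hinj.injOn]
    _ ≤ 2 * Fintype.card C * ∑ B, k B :=
        mul_le_mul_of_nonneg_left (sum_le_sum_of_subset_of_nonneg (subset_univ _)
          fun B _ _ => hk0 B) (by positivity)

/-- With m vertices the constant is #E (path length) · m² (congestion) · 2m (inverse flow), doubled
by the 1/2 in the Dirichlet form; `oddSum H x ∅` cancels. -/
theorem wormWeight_poincare (hx0 : ∀ e ∈ H.edgeFinset, 0 < x e)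
    (hx1 : ∀ e ∈ H.edgeFinset, x e ≤ 1) {f : State H → ℝ}
    (hf : ∑ A, wormWeight H x A * f A = 0) :
    ∑ A, wormWeight H x A * f A ^ 2
      ≤ 4 * (Fintype.card C : ℝ) ^ 3 * #H.edgeFinset
        * (1 / 2 * ∑ A, ∑ B, wormWeight H x A * transition H x A B * (f A - f B) ^ 2) := by
  set g : Finset (Sym2 C) → ℝ := fun A => if h : A ∈ states H then f ⟨A, mem_states.1 h⟩ else 0
    with hg
  have hgf (A : State H) : g A.1 = f A := by
    rw [hg]
    exact dif_pos (mem_states.2 A.2)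
  have h0 : ∑ A ∈ states H, xi A * weight x A * g A = 0 := by
    rw [sum_states, ← hf]
    exact sum_congr rfl fun A _ => by rw [hgf, wormWeight_eq]
  have h1 := oddSum_mul_sum_sq_le hx0 h0
  have h2 := sum_states_flow_le hx0 hx1 g
  have h3 := sum_weight_insert_le hx0 hx1 g
  have hZ := oddSum_empty_pos hx0
  have h4 : ∑ A ∈ states H, xi A * weight x A * g A ^ 2 = ∑ A, wormWeight H x A * f A ^ 2 := by
    rw [sum_states]
    exact sum_congr rfl fun A _ => by rw [hgf, wormWeight_eq]
  simp only [hgf] at h3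
  rw [h4] at h1
  refine le_of_mul_le_mul_left (h1.trans (h2.trans ((mul_le_mul_of_nonneg_left h3 ?_).trans_eq ?_)))
    hZ
  · positivity
  · ring

end Worm

namespace Worm

variable {C : Type*} [Fintype C] [DecidableEq C] {H : SimpleGraph C} [DecidableRel H.Adj]
  {x : Sym2 C → ℝ}

/-! ### Mixing time of the worm process -/

theorem two_le_card_of_edge (hE : H.edgeFinset.Nonempty) : 2 ≤ Fintype.card C := by
  obtain ⟨e, he⟩ := hE
  induction e using Sym2.ind with
  | _ u v =>
    rw [SimpleGraph.mem_edgeFinset, SimpleGraph.mem_edgeSet] at he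
    exact Fintype.one_lt_card_iff.2 ⟨u, v, he.ne⟩

theorem xi_le (hN : 2 ≤ Fintype.card C) (A : Finset (Sym2 C)) : xi A ≤ Fintype.card C := by
  have : (2 : ℝ) ≤ Fintype.card C := by exact_mod_cast hN
  rw [xi]
  split_ifs
  exacts [le_rfl, this]

theorem one_le_xi (hN : 2 ≤ Fintype.card C) (A : Finset (Sym2 C)) : 1 ≤ xi A := by
  have : (2 : ℝ) ≤ Fintype.card C := by exact_mod_cast hN
  rw [xi]
  split_ifs <;> linarith

theorem wormWeight_pos (hN : 2 ≤ Fintype.card C) (hx0 : ∀ e ∈ H.edgeFinset, 0 < x e)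
    (A : State H) : 0 < wormWeight H x A := by
  rw [wormWeight_eq]
  exact mul_pos (zero_lt_one.trans_le (one_le_xi hN _)) (weight_pos hx0 A.2.1)

instance nonempty_state : Nonempty (State H) := ⟨⟨∅, by simp⟩⟩

theorem sum_wormWeight_pos (hN : 2 ≤ Fintype.card C) (hx0 : ∀ e ∈ H.edgeFinset, 0 < x e) :
    0 < ∑ A, wormWeight H x A :=
  sum_pos (fun A _ => wormWeight_pos hN hx0 A) univ_nonempty

theorem sum_wormWeight_le (hN : 2 ≤ Fintype.card C) (hx0 : ∀ e ∈ H.edgeFinset, 0 < x e)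
    (hx1 : ∀ e ∈ H.edgeFinset, x e ≤ 1) :
    ∑ A, wormWeight H x A ≤ 2 ^ #H.edgeFinset * Fintype.card C := by
  simp only [wormWeight_eq]
  rw [← sum_states fun A => xi A * weight x A]
  calc ∑ A ∈ states H, xi A * weight x A
      ≤ ∑ A ∈ H.edgeFinset.powerset, xi A * weight x A :=
        sum_le_sum_of_subset_of_nonneg (filter_subset _ _) fun A hA _ =>
          mul_nonneg (xi_nonneg A) (weight_pos hx0 (mem_powerset.1 hA)).le
    _ ≤ ∑ A ∈ H.edgeFinset.powerset, (Fintype.card C : ℝ) := by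
        refine sum_le_sum fun A hA => ?_
        have h := mul_le_mul (xi_le hN A) (weight_le_one hx0 hx1 (mem_powerset.1 hA))
          (weight_pos hx0 (mem_powerset.1 hA)).le (Nat.cast_nonneg _)
        rwa [mul_one] at h
    _ = _ := by rw [sum_const, card_powerset, nsmul_eq_mul]; push_cast; rfl

theorem pow_le_wormWeight (hN : 2 ≤ Fintype.card C) (hx0 : ∀ e ∈ H.edgeFinset, 0 < x e)
    {δ : ℝ} (hδ0 : 0 ≤ δ) (hδ1 : δ ≤ 1)
    (hδ : ∀ e ∈ H.edgeFinset, δ ≤ x e) (A : State H) :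
    δ ^ #H.edgeFinset ≤ wormWeight H x A := by
  rw [wormWeight_eq]
  calc δ ^ #H.edgeFinset ≤ δ ^ #A.1 := pow_le_pow_of_le_one hδ0 hδ1 (card_le_card A.2.1)
    _ = ∏ e ∈ A.1, δ := by rw [prod_const]
    _ ≤ weight x A.1 := prod_le_prod (fun _ _ => hδ0) fun e he => hδ e (A.2.1 he)
    _ ≤ _ := le_mul_of_one_le_left (weight_pos hx0 A.2.1).le (one_le_xi hN _)

/-- At most 2^#E states, each of weight at most the number of vertices and at least δ^#E. -/
theorem log_inv_wormMeasure_le (hN : 2 ≤ Fintype.card C) (hx0 : ∀ e ∈ H.edgeFinset, 0 < x e)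
    (hx1 : ∀ e ∈ H.edgeFinset, x e ≤ 1) {δ : ℝ} (hδ0 : 0 < δ) (hδ1 : δ ≤ 1)
    (hδ : ∀ e ∈ H.edgeFinset, δ ≤ x e) (A : State H) :
    Real.log (1 / wormMeasure H x A)
      ≤ #H.edgeFinset * Real.log (2 / δ) + Real.log (Fintype.card C) := by
  have hN0 : (0 : ℝ) < Fintype.card C := by exact_mod_cast (by omega : 0 < Fintype.card C)
  have hω := wormWeight_pos hN hx0 A
  have hZ := sum_wormWeight_pos hN hx0
  rw [← Real.log_pow, ← Real.log_mul (by positivity) hN0.ne', wormMeasure, one_div_div]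
  refine Real.log_le_log (by positivity) ?_
  calc _ ≤ (2 ^ #H.edgeFinset * Fintype.card C) / δ ^ #H.edgeFinset :=
        div_le_div₀ (by positivity) (sum_wormWeight_le hN hx0 hx1) (by positivity)
          (pow_le_wormWeight hN hx0 hδ0.le hδ1 hδ A)
    _ = _ := by rw [div_pow]; ring

theorem wormMeasure_mul_transition_comm (hx0 : ∀ e ∈ H.edgeFinset, 0 < x e) (A B : State H) :
    wormMeasure H x A * transition H x A B = wormMeasure H x B * transition H x B A := by
  rw [wormMeasure, wormMeasure, div_mul_eq_mul_div, div_mul_eq_mul_div,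
    wormWeight_mul_transition_comm hx0]

theorem sum_wormMeasure (hN : 2 ≤ Fintype.card C) (hx0 : ∀ e ∈ H.edgeFinset, 0 < x e) :
    ∑ A, wormMeasure H x A = 1 := by
  simp only [wormMeasure]
  rw [← sum_div, div_self (sum_wormWeight_pos hN hx0).ne']

theorem wormMeasure_pos (hN : 2 ≤ Fintype.card C) (hx0 : ∀ e ∈ H.edgeFinset, 0 < x e)
    (A : State H) : 0 < wormMeasure H x A :=
  div_pos (wormWeight_pos hN hx0 A) (sum_wormWeight_pos hN hx0)

theorem isStationary_transition (hN : 2 ≤ Fintype.card C) (hx0 : ∀ e ∈ H.edgeFinset, 0 < x e)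
    (hx1 : ∀ e ∈ H.edgeFinset, x e ≤ 1) :
    MarkovChain.IsStationary (transition H x) (wormMeasure H x) := by
  refine ⟨Matrix.mem_rowStochastic_iff_sum.2 ⟨transition_nonneg hx0 hx1, sum_transition x⟩,
    ⟨fun A => (wormMeasure_pos hN hx0 A).le, sum_wormMeasure hN hx0⟩, ?_⟩
  ext B
  simp only [Matrix.vecMul, dotProduct, wormMeasure_mul_transition_comm hx0 _ B]
  rw [← mul_sum, sum_transition, mul_one]

theorem wormMeasure_poincare (hN : 2 ≤ Fintype.card C) (hx0 : ∀ e ∈ H.edgeFinset, 0 < x e)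
    (hx1 : ∀ e ∈ H.edgeFinset, x e ≤ 1) {f : State H → ℝ}
    (hf : ∑ A, wormMeasure H x A * f A = 0) :
    ∑ A, wormMeasure H x A * f A ^ 2
      ≤ 4 * (Fintype.card C : ℝ) ^ 3 * #H.edgeFinset
        * (1 / 2 * ∑ A, ∑ B, wormMeasure H x A * transition H x A B * (f A - f B) ^ 2) := by
  have hZ := sum_wormWeight_pos hN hx0
  have hf' : (∑ A, wormWeight H x A * f A) / ∑ B, wormWeight H x B = 0 := by
    rw [← hf]
    simp only [wormMeasure, div_mul_eq_mul_div, ← sum_div]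
  have h1 : ∑ A, wormMeasure H x A * f A ^ 2
      = (∑ A, wormWeight H x A * f A ^ 2) / ∑ B, wormWeight H x B := by
    simp only [wormMeasure, div_mul_eq_mul_div, ← sum_div]
  have h2 : ∑ A, ∑ B, wormMeasure H x A * transition H x A B * (f A - f B) ^ 2
      = (∑ A, ∑ B, wormWeight H x A * transition H x A B * (f A - f B) ^ 2)
        / ∑ B, wormWeight H x B := by
    simp only [wormMeasure, div_mul_eq_mul_div, ← sum_div]
  rw [h1, h2]
  refine (div_le_div_of_nonneg_right (wormWeight_poincare hx0 hx1
    ((div_eq_zero_iff.1 hf').resolve_right hZ.ne')) hZ.le).trans_eq ?_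
  ring

theorem exists_mixingTime_transition (hE : H.edgeFinset.Nonempty)
    (hx0 : ∀ e ∈ H.edgeFinset, 0 < x e) (hx1 : ∀ e ∈ H.edgeFinset, x e ≤ 1)
    {δ : ℝ} (hδ0 : 0 < δ) (hδ : ∀ e ∈ H.edgeFinset, δ ≤ x e)
    {ε : ℝ} (hε0 : 0 < ε) (hε1 : ε ≤ 1) {n : ℕ} (hn : Fintype.card C ≤ n) :
    ∃ t : ℕ, MarkovChain.mixingTime (transition H x) (wormMeasure H x) ε = t ∧
      (t : ℝ) ≤ 4 * (n : ℝ) ^ 5 * (#H.edgeFinset : ℝ) ^ 2 *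
        (Real.log (2 * ε⁻¹) / (#H.edgeFinset : ℝ) + Real.log (2 / δ)) := by
  have hN := two_le_card_of_edge hE
  have hδ1 : δ ≤ 1 := by
    obtain ⟨e, he⟩ := hE
    exact (hδ e he).trans (hx1 e he)
  have hm : (1 : ℝ) ≤ #H.edgeFinset := by exact_mod_cast hE.card_pos
  have hNR : (2 : ℝ) ≤ Fintype.card C := by exact_mod_cast hN
  have hnR : (Fintype.card C : ℝ) ≤ n := by exact_mod_cast hn
  have hlog := log_inv_wormMeasure_le hN hx0 hx1 hδ0 hδ1 hδ
  set m : ℝ := ((#H.edgeFinset : ℕ) : ℝ) with hm_def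
  set N : ℝ := ((Fintype.card C : ℕ) : ℝ) with hN_def
  set L := Real.log (2 / δ) with hL
  set l := Real.log (1 / ε) with hl
  have hl0 : 0 ≤ l := Real.log_nonneg (by rw [le_div_iff₀ hε0]; linarith)
  have hL2 : Real.log 2 ≤ L := Real.log_le_log (by norm_num) (by
    rw [le_div_iff₀ hδ0]; linarith)
  have hlogε : Real.log (2 * ε⁻¹) = Real.log 2 + l := by
    rw [hl, one_div, Real.log_mul (by norm_num) (by positivity)]
  have hlog2 : 0.69 ≤ Real.log 2 := by linarith [Real.log_two_gt_d9]
  have hlogN : Real.log N ≤ N - 1 := Real.log_le_sub_one_of_pos (by linarith)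
  set K := 4 * N ^ 3 * m with hK_def
  have hN3 : 1 ≤ N ^ 3 := one_le_pow₀ (by linarith)
  have hK : 1 ≤ K := by nlinarith
  have hmL : Real.log 2 ≤ m * L := by nlinarith
  -- Here m counts edges and N vertices. As 1 + log N ≤ N and N² ≥ 4, the factor N² absorbs the
  -- rounding, log N and the doubled l; it raises N³ to N⁵.
  have hbudget : 1 + (m * L + Real.log N + 2 * l) ≤ N ^ 2 * (Real.log 2 + l + m * L) := by
    nlinarith [mul_le_mul hNR hNR (by norm_num) (by linarith)]
  have hB : K * (1 + (m * L + Real.log N + 2 * l))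
      ≤ 4 * (n : ℝ) ^ 5 * m ^ 2 * (Real.log (2 * ε⁻¹) / m + L) := by
    calc _ ≤ K * (N ^ 2 * (Real.log 2 + l + m * L)) :=
          mul_le_mul_of_nonneg_left hbudget (by linarith)
      _ = N ^ 5 * (4 * m * (Real.log 2 + l + m * L)) := by rw [hK_def]; ring
      _ ≤ (n : ℝ) ^ 5 * (4 * m * (Real.log 2 + l + m * L)) :=
          mul_le_mul_of_nonneg_right (pow_le_pow_left₀ (by linarith) hnR 5)
            (mul_nonneg (by linarith) (by linarith))
      _ = _ := by
          rw [hlogε]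
          field_simp
  have hR0 : 0 ≤ m * L + Real.log N + 2 * l := by
    have := Real.log_nonneg (by linarith : 1 ≤ N)
    linarith
  -- Rounding up costs at most 1 ≤ K, already counted in `hB`.
  refine MarkovChain.exists_mixingTime_eq (t := ⌈K * (m * L + Real.log N + 2 * l)⌉₊)
    (fun A => MarkovChain.tvDist_le_of_poincare (wormMeasure_pos hN hx0) (sum_wormMeasure hN hx0)
      (transition_nonneg hx0 hx1) (sum_transition x) (wormMeasure_mul_transition_comm hx0)
      (half_le_transition_self hx0 hx1) hK (fun f hf => wormMeasure_poincare hN hx0 hx1 hf)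
      hε0 _ A (le_trans ?_ (Nat.le_ceil _))) ?_
  · exact mul_le_mul_of_nonneg_left (by linarith [hlog A]) (by linarith)
  · have := Nat.ceil_lt_add_one (mul_nonneg (by linarith : 0 ≤ K) hR0)
    linarith

end Worm

namespace FourVertex

variable {V E : Type*} {G : Graph V E}

/-! ### Counting circuits -/

theorem circuitOf_across (lab : Labelling G) (h : HalfEdge G) :
    circuitOf lab (across lab h) = circuitOf lab h :=
  Quotient.sound (Relation.EqvGen.symm _ _ (Relation.EqvGen.rel _ _ (Or.inr rfl)))

theorem opp_fst_ne [G.Loopless] (h : HalfEdge G) : (opp h).1 ≠ h.1 := by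
  intro heq
  have hi : G.Inc (h.2 : E) (h.1 : V) := h.2.2
  exact hi.isLink_other.ne (congrArg Subtype.val heq).symm

theorem across_edge_ne (lab : Labelling G) (h : HalfEdge G) :
    ((across lab h).2 : E) ≠ (h.2 : E) := by
  intro heq
  have h1 : lab h.1 (Fin.rev ((lab h.1).symm h.2)) = h.2 := Subtype.ext heq
  rw [← Equiv.eq_symm_apply] at h1
  generalize (lab h.1).symm h.2 = k at h1
  revert k
  decide

/-- From a representative, `across` and `opp` reach four distinct half-edges of the circuit: `opp`
changes the vertex (no loops) but not the edge, `across` the edge but not the vertex. There are 4n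
half-edges in all. -/
theorem card_circuit_le [G.Loopless] [Finite V(G)] (lab : Labelling G) :
    Fintype.card (Circuit lab) ≤ Nat.card V(G) := by
  have hrep (c : Circuit lab) : ∃ h, circuitOf lab h = c := Quotient.exists_rep c
  choose rep hrep using hrep
  let φ : Circuit lab × Bool × Bool → HalfEdge G := fun p =>
    let h := if p.2.1 then across lab (rep p.1) else rep p.1
    if p.2.2 then opp h else h
  have hφc (c : Circuit lab) (a b : Bool) : circuitOf lab (φ (c, a, b)) = c := by
    cases a <;> cases b <;> simp [φ, circuitOf_opp, circuitOf_across, hrep]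
  have hφv (c : Circuit lab) (a b : Bool) : (φ (c, a, b)).1 = (rep c).1 ↔ b = false := by
    cases b
    · cases a <;> simp [φ] <;> rfl
    · cases a
      · simpa [φ] using opp_fst_ne (rep c)
      · simp only [φ, if_true, Bool.true_eq_false, iff_false]
        exact opp_fst_ne (across lab (rep c))
  have hφe (c : Circuit lab) (a b : Bool) :
      ((φ (c, a, b)).2 : E) = ((rep c).2 : E) ↔ a = false := by
    cases a
    · cases b <;> simp [φ] <;> rfl
    · cases b <;> simp only [φ, Bool.true_eq_false, iff_false] <;> exact across_edge_ne lab (rep c)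
  have hφ : Function.Injective φ := by
    rintro ⟨c, a, b⟩ ⟨c', a', b'⟩ h
    obtain rfl : c = c' := by rw [← hφc c a b, h, hφc]
    have h1 := hφv c a b
    have h2 := hφe c a b
    rw [h, hφv] at h1
    rw [h, hφe] at h2
    have hb : b = b' := by cases b <;> cases b' <;> simp_all
    have ha : a = a' := by cases a <;> cases a' <;> simp_all
    rw [ha, hb]
  let ψ : HalfEdge G ≃ V(G) × Fin 4 :=
    (Equiv.sigmaCongrRight fun v => (lab v).symm).trans (Equiv.sigmaEquivProd _ _)
  have h := Nat.card_le_card_of_injective _ (ψ.injective.comp hφ)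
  simp only [Nat.card_prod, Nat.card_eq_fintype_card (α := Bool), Fintype.card_bool,
    Nat.card_eq_fintype_card (α := Fin 4), Fintype.card_fin] at h
  rw [Fintype.card_eq_nat_card]
  omega

/-! ### The effect of moving initial half-edges -/

theorem change_value {lab : Labelling G} (I : Initial lab) (X : Circuit lab → ZMod 2)
    {σ : HalfEdge G → Bool} (hσ : IsValid lab σ) (c : Circuit lab) :
    σ ((I.change X).edge c) = if X c = 1 then !σ (I.edge c) else σ (I.edge c) := by
  simp only [Initial.change]
  split_ifs
  · exact hσ.1 _
  · rfl

theorem zmod_two_cases (a : ZMod 2) : a = 0 ∨ a = 1 := by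
  revert a; decide

theorem value_change_eq_iff_of_add_eq_zero {lab : Labelling G} (I : Initial lab)
    {X : Circuit lab → ZMod 2} {c d : Circuit lab} (h : X c + X d = 0)
    {σ : HalfEdge G → Bool} (hσ : IsValid lab σ) :
    σ ((I.change X).edge c) = σ ((I.change X).edge d) ↔ σ (I.edge c) = σ (I.edge d) := by
  rw [change_value I X hσ, change_value I X hσ]
  rcases zmod_two_cases (X c) with hc | hc <;> rcases zmod_two_cases (X d) with hd | hd <;>
    simp_all

theorem value_change_eq_iff_of_add_eq_one {lab : Labelling G} (I : Initial lab)
    {X : Circuit lab → ZMod 2} {c d : Circuit lab} (h : X c + X d = 1)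
    {σ : HalfEdge G → Bool} (hσ : IsValid lab σ) :
    σ ((I.change X).edge c) = σ ((I.change X).edge d) ↔ ¬ σ (I.edge c) = σ (I.edge d) := by
  rw [change_value I X hσ, change_value I X hσ]
  have h2 : (1 : ZMod 2) + 1 = 0 := rfl
  rcases zmod_two_cases (X c) with hc | hc <;> rcases zmod_two_cases (X d) with hd | hd <;>
    cases σ (I.edge c) <;> cases σ (I.edge d) <;> simp_all

variable {β : ℝ} {lab : Labelling G} {I : Initial lab} {X : Circuit lab → ZMod 2}
  {c d : Circuit lab}

theorem num_change_of_add_eq_zero (h : X c + X d = 0) :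
    numAgree β lab (I.change X) c d = numAgree β lab I c d ∧
      numDisagree β lab (I.change X) c d = numDisagree β lab I c d := by
  constructor
  · refine congrArg Set.ncard (Set.ext fun v => and_congr_right fun _ => forall₂_congr ?_)
    intro σ hσ
    simp only [value_change_eq_iff_of_add_eq_zero I h hσ]
  · refine congrArg Set.ncard (Set.ext fun v => and_congr_right fun _ => forall₂_congr ?_)
    intro σ hσ
    simp only [value_change_eq_iff_of_add_eq_zero I h hσ]

/-- Exactly one of the two circuit values is negated, so "equal" and "different" trade places. -/
theorem num_change_of_add_eq_one (h : X c + X d = 1) :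
    numAgree β lab (I.change X) c d = numDisagree β lab I c d ∧
      numDisagree β lab (I.change X) c d = numAgree β lab I c d := by
  constructor
  · refine congrArg Set.ncard (Set.ext fun v => and_congr_right fun _ => forall₂_congr ?_)
    intro σ hσ
    simp only [value_change_eq_iff_of_add_eq_one I h hσ, ite_not]
  · refine congrArg Set.ncard (Set.ext fun v => and_congr_right fun _ => forall₂_congr ?_)
    intro σ hσ
    simp only [value_change_eq_iff_of_add_eq_one I h hσ, ite_not]

/-- The linear system exchanges the two counts exactly when they are in the wrong order; `hne` makes
the result strict. -/
theorem numDisagree_lt_numAgree_change (hX : SolvesFerro β lab I X)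
    (hadj : (circuitGraph lab).Adj c d) (hne : numAgree β lab I c d ≠ numDisagree β lab I c d) :
    numDisagree β lab (I.change X) c d < numAgree β lab (I.change X) c d := by
  have h := hX c d hadj
  split_ifs at h with hlt
  · rwa [(num_change_of_add_eq_one h).1, (num_change_of_add_eq_one h).2]
  · rw [(num_change_of_add_eq_zero h).1, (num_change_of_add_eq_zero h).2]
    omega

theorem numAgree_lt_numDisagree_change (hX : SolvesAntiferro β lab I X)
    (hadj : (circuitGraph lab).Adj c d) (hne : numAgree β lab I c d ≠ numDisagree β lab I c d) :
    numAgree β lab (I.change X) c d < numDisagree β lab (I.change X) c d := by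
  have h := hX c d hadj
  split_ifs at h with hlt
  · rwa [(num_change_of_add_eq_one h).1, (num_change_of_add_eq_one h).2]
  · rw [(num_change_of_add_eq_zero h).1, (num_change_of_add_eq_zero h).2]
    omega

theorem one_lt_edgeBeta_change (hX : (1 < β ∧ SolvesFerro β lab I X) ∨
      (0 < β ∧ β < 1 ∧ SolvesAntiferro β lab I X))
    (hAD : ∀ c d, (circuitGraph lab).Adj c d → numAgree β lab I c d ≠ numDisagree β lab I c d)
    {e : Sym2 (Circuit lab)} (he : e ∈ (circuitGraph lab).edgeSet) :
    1 < edgeBeta β lab (I.change X) e := by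
  induction e using Sym2.ind with
  | _ c d =>
    rw [SimpleGraph.mem_edgeSet] at he
    change 1 < β ^ ((numAgree β lab (I.change X) c d : ℤ)
      - (numDisagree β lab (I.change X) c d : ℤ))
    rcases hX with ⟨hβ, hX⟩ | ⟨hβ0, hβ1, hX⟩
    · have := numDisagree_lt_numAgree_change hX he (hAD c d he)
      exact one_lt_zpow₀ hβ (by omega)
    · have := numAgree_lt_numDisagree_change hX he (hAD c d he)
      exact one_lt_zpow_of_neg₀ hβ0 hβ1 (by omega)

end FourVertex

/-! ### The worm bound applied to the graph of circuits -/

theorem mainTheorem2 {V E : Type*} (G : Graph V E) [G.Loopless] [Finite (Graph.vertexSet G)]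
    (hconn : ∀ v ∈ Graph.vertexSet G, ∀ w ∈ Graph.vertexSet G, Relation.ReflTransGen G.Adj v w)
    (lab : FourVertex.Labelling G) (β : ℝ) (I : FourVertex.Initial lab)
    (X : FourVertex.Circuit lab → ZMod 2)
    (hX : (1 < β ∧ FourVertex.SolvesFerro β lab I X) ∨
      (0 < β ∧ β < 1 ∧ FourVertex.SolvesAntiferro β lab I X))
    (hE : (FourVertex.circuitGraph lab).edgeSet.Nonempty)
    (hAD : ∀ c d, (FourVertex.circuitGraph lab).Adj c d →
      FourVertex.numAgree β lab I c d ≠ FourVertex.numDisagree β lab I c d)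
    (ε : ℝ) (hε₀ : 0 < ε) (hε₁ : ε ≤ 1) :
    MarkovChain.IsStationary
        (Worm.transition (FourVertex.circuitGraph lab) (FourVertex.edgeX β lab (I.change X)))
        (Worm.wormMeasure (FourVertex.circuitGraph lab) (FourVertex.edgeX β lab (I.change X))) ∧
    ∃ t : ℕ,
      MarkovChain.mixingTime
        (Worm.transition (FourVertex.circuitGraph lab) (FourVertex.edgeX β lab (I.change X)))
        (Worm.wormMeasure (FourVertex.circuitGraph lab) (FourVertex.edgeX β lab (I.change X)))
        ε = t ∧
      (t : ℝ) ≤ 4 * (Nat.card (Graph.vertexSet G) : ℝ) ^ 5 *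
        (#(FourVertex.circuitGraph lab).edgeFinset : ℝ) ^ 2 *
        (Real.log (2 * ε⁻¹) / (#(FourVertex.circuitGraph lab).edgeFinset : ℝ) +
          Real.log (2 / FourVertex.xMin β lab (I.change X))) := by
  have hβ (e) (he : e ∈ (FourVertex.circuitGraph lab).edgeSet) :=
    FourVertex.one_lt_edgeBeta_change hX hAD he
  have hx0' (e) (he : e ∈ (FourVertex.circuitGraph lab).edgeSet) :
      0 < FourVertex.edgeX β lab (I.change X) e :=
    div_pos (by linarith [hβ e he]) (by linarith [hβ e he])
  have hx0 (e) (he : e ∈ (FourVertex.circuitGraph lab).edgeFinset) :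
      0 < FourVertex.edgeX β lab (I.change X) e :=
    hx0' e (SimpleGraph.mem_edgeFinset.1 he)
  have hx1 (e) (he : e ∈ (FourVertex.circuitGraph lab).edgeFinset) :
      FourVertex.edgeX β lab (I.change X) e ≤ 1 := by
    have := hβ e (SimpleGraph.mem_edgeFinset.1 he)
    rw [FourVertex.edgeX, div_le_one (by linarith)]
    linarith
  have hE' : (FourVertex.circuitGraph lab).edgeFinset.Nonempty :=
    SimpleGraph.edgeFinset_nonempty.2 (SimpleGraph.edgeSet_nonempty.1 hE)
  have : Nonempty (FourVertex.circuitGraph lab).edgeSet := hE.to_subtype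
  have hmin : 0 < FourVertex.xMin β lab (I.change X) := by
    -- Over finitely many edges the infimum is attained, hence positive.
    obtain ⟨e, he⟩ := exists_eq_ciInf_of_finite
      (f := fun e : (FourVertex.circuitGraph lab).edgeSet =>
        FourVertex.edgeX β lab (I.change X) e)
    rw [FourVertex.xMin, ← he]
    exact hx0' e.1 e.2
  refine ⟨Worm.isStationary_transition (Worm.two_le_card_of_edge hE') hx0 hx1,
    Worm.exists_mixingTime_transition hE' hx0 hx1 hmin (fun e he => ?_) hε₀ hε₁
      (FourVertex.card_circuit_le lab)⟩
  exact ciInf_le (Set.finite_range _).bddBelow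
    (⟨e, SimpleGraph.mem_edgeFinset.1 he⟩ : (FourVertex.circuitGraph lab).edgeSet)
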